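/- Let $Q=\prod_{j=1}^3[a_j,b_j]$ and $Q'=\prod_{j=1}^3[a'_j,b'_j]$ with $a_j\le b_j$, $a'_j\le b'_j$ be cuboids in $\mathbb R^3$, and let $n=(n_1,n_2,n_3)$, $m=(m_1,m_2,m_3)\in\mathbb N_0^3$. Write $x^n=x_1^{n_1}x_2^{n_2}x_3^{n_3}$, $y^m=y_1^{m_1}y_2^{m_2}y_3^{m_3}$, let $|\cdot|$ be the Euclidean norm, and consider the Newton potential and the force components $$V=\int_Q\int_{Q'}\frac{x^n y^m}{|x-y|}\,dy\,dx,\qquad F_j=\int_Q\int_{Q'}\frac{(x_j-y_j)\,x^n y^m}{|x-y|^{3}}\,dy\,dx\quad(j=1,2,3).$$ The integrands are absolutely integrable on $Q\times Q'$, and $V$, $F_1$, $F_2$, $F_3$ are each a linear combination of terms of the form $$\frac1{\rho_\delta},\qquad \operatorname{arctanh}\frac{\delta_3}{\rho_\delta},\qquad \arctan\frac{\delta_2\delta_3}{\delta_1\rho_\delta},\qquad \rho_\delta=\sqrt{\delta_1^2+\delta_2^2+\delta_3^2},$$ where $\delta=(\delta_1,\delta_2,\delta_3)$ satisfies $\delta_1\neq0$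 and is, up to a permutation of its components, the componentwise difference of a vertex of $Q$ and a vertex of $Q'$. The coefficients are rational polynomials in the integration bounds: for each pair of vertices (specified by the choice of lower or upper bound in each coordinate), each permutation and each of the three forms, the coefficient is the value at $(a,b,a',b')$ of a polynomial in twelve variables with rational coefficients. These polynomials depend only on $n$, $m$ and on which of the quantities $V,F_1,F_2,F_3$ is considered, not on the bounds; at given bounds, the sum extends over those vertex pairs and permutations for which $\delta_1\ne0$. -/

import Mathlib

open MeasureTheory

noncomputable section

namespace Cuboid

/-- `|x - y|`, the Euclidean distance in three-space, written out in coordinates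
(`Fin 3 → ℝ` itself carries the sup norm). -/
def dist3 (x y : Fin 3 → ℝ) : ℝ := Real.sqrt (∑ i, (x i - y i) ^ 2)

/-- The weight `x₁^{n₁} x₂^{n₂} x₃^{n₃} y₁^{m₁} y₂^{m₂} y₃^{m₃}`. -/
def weight (n m : Fin 3 → ℕ) (x y : Fin 3 → ℝ) : ℝ :=
  (∏ i, x i ^ n i) * ∏ i, y i ^ m i

/-- The integrand of the Newton potential. -/
def potentialKernel (n m : Fin 3 → ℕ) (x y : Fin 3 → ℝ) : ℝ :=
  weight n m x y / dist3 x y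

/-- The integrand of the `j`-th force component. -/
def forceKernel (n m : Fin 3 → ℕ) (j : Fin 3) (x y : Fin 3 → ℝ) : ℝ :=
  (x j - y j) * weight n m x y / dist3 x y ^ 3

/-- The integral of `K x y` for `x` in the cuboid `[a, b]` and `y` in the cuboid `[a', b']`.
For the product order, `Set.Icc a b` is `[a₁,b₁] × [a₂,b₂] × [a₃,b₃]`. -/
def doubleIntegral (K : (Fin 3 → ℝ) → (Fin 3 → ℝ) → ℝ) (a b a' b' : Fin 3 → ℝ) : ℝ :=
  ∫ x in Set.Icc a b, ∫ y in Set.Icc a' b', K x y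

/-- The Newton potential `V` of the cuboids `Q = [a, b]` and `Q' = [a', b']`. -/
def potential (n m : Fin 3 → ℕ) (a b a' b' : Fin 3 → ℝ) : ℝ :=
  doubleIntegral (potentialKernel n m) a b a' b'

/-- The force component `F_j` of the cuboids `Q = [a, b]` and `Q' = [a', b']`. -/
def force (n m : Fin 3 → ℕ) (j : Fin 3) (a b a' b' : Fin 3 → ℝ) : ℝ :=
  doubleIntegral (forceKernel n m j) a b a' b'

/-- The vertex of the cuboid `[a, b]` selected by `s`. -/
def vertex (a b : Fin 3 → ℝ) (s : Fin 3 → Bool) : Fin 3 → ℝ :=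
  fun i => if s i then b i else a i

/-- The difference of a vertex of `[a, b]` and a vertex of `[a', b']`, its components
permuted by `π`. The components `δ 0, δ 1, δ 2` are `δ₁, δ₂, δ₃`. -/
def delta (a b a' b' : Fin 3 → ℝ) (s s' : Fin 3 → Bool) (π : Equiv.Perm (Fin 3)) :
    Fin 3 → ℝ :=
  fun i => vertex a b s (π i) - vertex a' b' s' (π i)

/-- `ρ_δ`. -/
def rho (δ : Fin 3 → ℝ) : ℝ := Real.sqrt (δ 0 ^ 2 + δ 1 ^ 2 + δ 2 ^ 2)

/-- Names of the twelve integration bounds: those of `a`, `b`, `a'` and `b'`, in this order. -/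
abbrev BoundVar : Type := (Fin 3 ⊕ Fin 3) ⊕ (Fin 3 ⊕ Fin 3)

/-- The values of the twelve integration bounds. -/
def bounds (a b a' b' : Fin 3 → ℝ) : BoundVar → ℝ :=
  Sum.elim (Sum.elim a b) (Sum.elim a' b')

/-- For each pair of vertices and each permutation, a polynomial with rational coefficients
in the twelve integration bounds, taken as indeterminates. -/
abbrev Coeffs : Type :=
  (Fin 3 → Bool) → (Fin 3 → Bool) → Equiv.Perm (Fin 3) → MvPolynomial BoundVar ℚ

/-- The linear combination of the terms `1 / ρ_δ`, `artanh (δ₃ / ρ_δ)` and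
`arctan (δ₂ δ₃ / (δ₁ ρ_δ))` with coefficients `A`, `B`, `C` evaluated at the integration bounds,
extended over all permuted vertex differences `δ` that satisfy `δ₁ ≠ 0`. -/
def elementaryCombination (A B C : Coeffs) (a b a' b' : Fin 3 → ℝ) : ℝ :=
  ∑ s : Fin 3 → Bool, ∑ s' : Fin 3 → Bool, ∑ π : Equiv.Perm (Fin 3),
    let δ := delta a b a' b' s s' π
    let val : MvPolynomial BoundVar ℚ → ℝ := fun P => MvPolynomial.aeval (bounds a b a' b') P
    open Classical in
    if δ 0 ≠ 0 then
      val (A s s' π) * (1 / rho δ)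
        + val (B s s' π) * Real.artanh (δ 2 / rho δ)
        + val (C s s' π) * Real.arctan (δ 1 * δ 2 / (δ 0 * rho δ))
    else 0

end Cuboid

end

/-! The integral is evaluated by six successive antiderivatives, three in `y` and then three in `x`,
inside spaces of functions that are linear over the polynomials in `x` and `y`. With `z = x - y`,
the regular terms are `ρ`, `z_i artanh(z_j/ρ)` with `i ≠ j`, and `z_i arctan(z_j z_k/(z_i ρ))`. The
factor `z_i` makes them continuous on all of space, and their polynomial span is closed under
antidifferentiation in each of the six coordinates (`polySpan_regularTerms_le_primitive`). This
rests on integration by parts and on recursions in the power of `z_i` that use `ρ² = z_i² + z_j² +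
z_k²`.

The kernels `1/ρ` and `z_j/ρ³` are not in this span. One antiderivative leads to regular terms
together with `1/ρ` and `artanh(z_k/ρ)` for the first direction `k`, a second one leaves only
`artanh(z_i/ρ)` for the second direction `i`, and after the third everything is regular
(`polySpan_firstTerms_le_primitive`, `polySpan_secondTerms_le_primitive`).

Antiderivatives are differentiated only where all `z_l ≠ 0`; continuity carries the fundamental
theorem of calculus across the exceptional points. In the `y` integrals almost every line meets only
one such point. In the `x` integrals `y` is a vertex and all functions are continuous, so that a
limit covers every line.

At the vertices, each regular term becomes an admissible term whose coefficient vanishes with `δ₁`;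
for `ρ` one writes `ρ = ∑ z_i² · (1/ρ)` (`regular_mem_elementary`). Hence dropping the terms with
`δ₁ = 0` changes nothing, also for touching or degenerate cuboids. -/

namespace Cuboid

open Function

/-! ### Calculus of the elementary terms -/

/-- The indices `i`, `j`, `k` are pairwise distinct. -/
def IsTriple (i j k : Fin 3) : Prop := i ≠ j ∧ j ≠ k ∧ i ≠ k

theorem IsTriple.swap {i j k : Fin 3} (h : IsTriple i j k) : IsTriple i k j :=
  ⟨h.2.2, h.2.1.symm, h.1⟩

theorem IsTriple.swap' {i j k : Fin 3} (h : IsTriple i j k) : IsTriple j i k :=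
  ⟨h.1.symm, h.2.2, h.2.1⟩

theorem IsTriple.rotate {i j k : Fin 3} (h : IsTriple i j k) : IsTriple j k i :=
  ⟨h.2.1, h.2.2.symm, h.1.symm⟩

theorem exists_isTriple (i : Fin 3) : ∃ j k, IsTriple i j k := by
  unfold IsTriple; revert i; decide

theorem exists_isTriple_of_ne {i j : Fin 3} (h : i ≠ j) : ∃ k, IsTriple i j k := by
  unfold IsTriple; revert i j; decide

theorem IsTriple.eq_or {i j k : Fin 3} (h : IsTriple i j k) (l : Fin 3) :
    l = i ∨ l = j ∨ l = k := by
  unfold IsTriple at h; revert i j k l; decide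

theorem IsTriple.exists_perm {i j k : Fin 3} (h : IsTriple i j k) :
    ∃ π : Equiv.Perm (Fin 3), π 0 = i ∧ π 1 = j ∧ π 2 = k := by
  unfold IsTriple at h; revert i j k; decide

theorem rho_eq {i j k : Fin 3} (h : IsTriple i j k) (z : Fin 3 → ℝ) :
    rho z = Real.sqrt (z i ^ 2 + z j ^ 2 + z k ^ 2) := by
  obtain ⟨h1, h2, h3⟩ := h
  unfold rho
  congr 1
  fin_cases i <;> fin_cases j <;> fin_cases k <;> simp at h1 h2 h3 ⊢ <;> ring

theorem rho_nonneg (z : Fin 3 → ℝ) : 0 ≤ rho z := Real.sqrt_nonneg _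

theorem rho_sq {i j k : Fin 3} (h : IsTriple i j k) (z : Fin 3 → ℝ) :
    rho z ^ 2 = z i ^ 2 + z j ^ 2 + z k ^ 2 := by
  rw [rho_eq h, Real.sq_sqrt (by positivity)]

theorem rho_pos {z : Fin 3 → ℝ} {i : Fin 3} (hi : z i ≠ 0) : 0 < rho z := by
  obtain ⟨j, k, h⟩ := exists_isTriple i
  rw [rho_eq h]
  positivity

theorem abs_le_rho (z : Fin 3 → ℝ) (i : Fin 3) : |z i| ≤ rho z := by
  obtain ⟨j, k, h⟩ := exists_isTriple i
  rw [rho_eq h]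
  apply Real.abs_le_sqrt
  nlinarith [sq_nonneg (z j), sq_nonneg (z k)]

theorem continuous_rho : Continuous rho := by
  unfold rho; fun_prop

theorem sq_lt_rho_sq {z : Fin 3 → ℝ} {i j : Fin 3} (hij : i ≠ j) (hi : z i ≠ 0) :
    z j ^ 2 < rho z ^ 2 := by
  obtain ⟨k, h⟩ := exists_isTriple_of_ne hij
  rw [rho_sq h]
  have : 0 < z i ^ 2 := by positivity
  nlinarith [sq_nonneg (z k)]

theorem div_rho_mem_Ioo {z : Fin 3 → ℝ} {i j : Fin 3} (hij : i ≠ j) (hi : z i ≠ 0) :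
    z j / rho z ∈ Set.Ioo (-1 : ℝ) 1 := by
  have h := abs_lt_of_sq_lt_sq (sq_lt_rho_sq hij hi) (rho_nonneg z)
  have hp := rho_pos hi
  rw [abs_lt] at h
  constructor
  · rw [lt_div_iff₀ hp]; linarith
  · rw [div_lt_iff₀ hp]; linarith

theorem hasDerivAt_artanh {x : ℝ} (hx : x ∈ Set.Ioo (-1 : ℝ) 1) :
    HasDerivAt Real.artanh (1 / (1 - x ^ 2)) x := by
  have h1 : 0 < 1 + x := by linarith [hx.1]
  have h2 : 0 < 1 - x := by linarith [hx.2]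
  have hq : HasDerivAt (fun t : ℝ => (1 + t) / (1 - t))
      ((1 * (1 - x) - (1 + x) * (-1)) / (1 - x) ^ 2) x :=
    ((hasDerivAt_id x).const_add 1).div ((hasDerivAt_id x).const_sub 1) h2.ne'
  have hl := ((hq.log (by positivity)).const_mul (1 / 2))
  have hev : (fun t : ℝ => 1 / 2 * Real.log ((1 + t) / (1 - t))) =ᶠ[nhds x] Real.artanh := by
    filter_upwards [Ioo_mem_nhds hx.1 hx.2] with t ht
    rw [Real.artanh_eq_half_log ⟨ht.1.le, ht.2.le⟩]
  refine (hl.congr_of_eventuallyEq hev.symm).congr_deriv ?_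
  have h3 : (1 - x ^ 2) ≠ 0 := by nlinarith
  field_simp
  ring

theorem continuousAt_artanh {x : ℝ} (hx : x ∈ Set.Ioo (-1 : ℝ) 1) :
    ContinuousAt Real.artanh x := (hasDerivAt_artanh hx).continuousAt

/-- `artanh (z_j / ρ)`. -/
noncomputable def artanhTerm (j : Fin 3) (z : Fin 3 → ℝ) : ℝ := Real.artanh (z j / rho z)

/-- `arctan (z_j z_k / (z_i ρ))`. -/
noncomputable def arctanTerm (i j k : Fin 3) (z : Fin 3 → ℝ) : ℝ :=
  Real.arctan (z j * z k / (z i * rho z))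

/-! ### Partial derivatives of `ρ` and of the elementary terms. -/

section Derivatives

variable {i j k : Fin 3} {z : Fin 3 → ℝ}

theorem hasDerivAt_rho (hz : rho z ≠ 0) :
    HasDerivAt (fun t => rho (update z i t)) (z i / rho z) (z i) := by
  obtain ⟨j, k, h⟩ := exists_isTriple i
  have he : (fun t => rho (update z i t)) = fun t => Real.sqrt (t ^ 2 + z j ^ 2 + z k ^ 2) := by
    funext t
    rw [rho_eq h, update_self, update_of_ne h.1.symm, update_of_ne h.2.2.symm]
  have h0 : z i ^ 2 + z j ^ 2 + z k ^ 2 ≠ 0 := by rw [← rho_sq h]; positivity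
  rw [he]
  have := ((((hasDerivAt_pow 2 (z i)).add_const (z j ^ 2)).add_const (z k ^ 2)).sqrt h0)
  refine this.congr_deriv ?_
  rw [← rho_eq h]
  field_simp
  norm_num

theorem hasDerivAt_inv_rho (hz : rho z ≠ 0) :
    HasDerivAt (fun t => 1 / rho (update z i t)) (-(z i / rho z ^ 3)) (z i) := by
  have h := (hasDerivAt_rho (i := i) hz).fun_inv (by simpa using hz)
  simp only [update_eq_self] at h
  simp only [one_div]
  refine h.congr_deriv ?_
  field_simp

theorem hasDerivAt_artanhTerm_self (h : IsTriple i j k) (hj : z j ≠ 0) :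
    HasDerivAt (fun t => artanhTerm i (update z i t)) (1 / rho z) (z i) := by
  have hp := rho_pos hj
  have hq : HasDerivAt (fun t => update z i t i / rho (update z i t))
      ((1 * rho z - z i * (z i / rho z)) / rho z ^ 2) (z i) := by
    have := (hasDerivAt_id (z i)).fun_div (hasDerivAt_rho (i := i) hp.ne') (by simpa using hp.ne')
    simpa using this
  have hm := div_rho_mem_Ioo h.1.symm hj
  have := (hasDerivAt_artanh (x := update z i (z i) i / rho (update z i (z i)))
    (by simpa using hm)).comp (z i) hq
  refine HasDerivAt.congr_deriv this ?_
  simp only [update_eq_self]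
  have hs := rho_sq h z
  have hne : rho z ^ 2 - z i ^ 2 ≠ 0 := by
    have := sq_lt_rho_sq h.1.symm hj
    linarith
  field_simp

theorem hasDerivAt_artanhTerm_of_ne (h : IsTriple i j k) (hk : z k ≠ 0) :
    HasDerivAt (fun t => artanhTerm j (update z i t))
      (-(z i * z j / (rho z * (z i ^ 2 + z k ^ 2)))) (z i) := by
  have hp := rho_pos hk
  have hq : HasDerivAt (fun t => update z i t j / rho (update z i t))
      ((0 * rho z - z j * (z i / rho z)) / rho z ^ 2) (z i) := by
    have := (hasDerivAt_const (z i) (z j)).fun_div (hasDerivAt_rho (i := i) hp.ne')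
      (by simpa using hp.ne')
    simpa [update_of_ne h.1.symm] using this
  have hm := div_rho_mem_Ioo h.2.1.symm hk
  have := (hasDerivAt_artanh (x := update z i (z i) j / rho (update z i (z i)))
    (by simpa using hm)).comp (z i) hq
  refine HasDerivAt.congr_deriv this ?_
  simp only [update_eq_self]
  have hs := rho_sq h z
  have hne : z i ^ 2 + z k ^ 2 ≠ 0 := by positivity
  have he : 1 - (z j / rho z) ^ 2 = (z i ^ 2 + z k ^ 2) / rho z ^ 2 := by
    field_simp; linarith
  rw [he]
  field_simp
  ring

theorem hasDerivAt_arctanTerm_of_ne (h : IsTriple i j k) (hj : z j ≠ 0) :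
    HasDerivAt (fun t => arctanTerm j i k (update z i t))
      (z j * z k / (rho z * (z i ^ 2 + z j ^ 2))) (z i) := by
  have hp := rho_pos hj
  have hq : HasDerivAt (fun t => update z i t i * update z i t k /
        (update z i t j * rho (update z i t)))
      ((z k * (z j * rho z) - z i * z k * (z j * (z i / rho z))) / (z j * rho z) ^ 2) (z i) := by
    have := ((hasDerivAt_id (z i)).mul_const (z k)).fun_div
      ((hasDerivAt_rho (i := i) hp.ne').const_mul (z j))
      (by simpa using ⟨hj, hp.ne'⟩)
    simpa [update_of_ne h.1.symm, update_of_ne h.2.2.symm] using this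
  refine HasDerivAt.congr_deriv hq.arctan ?_
  simp only [update_eq_self]
  have hs := rho_sq h z
  have hne : z i ^ 2 + z j ^ 2 ≠ 0 := by positivity
  have he : 1 + (z i * z k / (z j * rho z)) ^ 2 =
      (z i ^ 2 + z j ^ 2) * (z j ^ 2 + z k ^ 2) / (z j * rho z) ^ 2 := by
    field_simp; rw [hs]; ring
  have hne' : z j ^ 2 + z k ^ 2 ≠ 0 := by positivity
  rw [he]
  field_simp
  rw [hs]; ring

/-- The identity `z_i² ρ² + z_j² z_k² = (z_i² + z_j²)(z_i² + z_k²)` factors the denominator, and the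
numerator contains `ρ² + z_i²`, the sum of the two factors. This gives partial fractions of the type
treated in `pow_mul_kernel_mem_primitive`. -/
theorem hasDerivAt_arctanTerm_self (h : IsTriple i j k) (hi : z i ≠ 0) (hj : z j ≠ 0)
    (hk : z k ≠ 0) :
    HasDerivAt (fun t => arctanTerm i j k (update z i t))
      (-(z j * z k / (rho z * (z i ^ 2 + z j ^ 2)) + z j * z k / (rho z * (z i ^ 2 + z k ^ 2))))
      (z i) := by
  have hp := rho_pos hj
  have hq : HasDerivAt (fun t => update z i t j * update z i t k /
        (update z i t i * rho (update z i t)))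
      ((0 * (z i * rho z) - z j * z k * (1 * rho z + z i * (z i / rho z))) / (z i * rho z) ^ 2)
      (z i) := by
    have := (hasDerivAt_const (z i) (z j * z k)).fun_div
      ((hasDerivAt_id (z i)).fun_mul (hasDerivAt_rho (i := i) hp.ne'))
      (by simpa using ⟨hi, hp.ne'⟩)
    simpa [update_of_ne h.1.symm, update_of_ne h.2.2.symm] using this
  refine HasDerivAt.congr_deriv hq.arctan ?_
  simp only [update_eq_self]
  have hs := rho_sq h z
  have hne : z i ^ 2 + z j ^ 2 ≠ 0 := by positivity
  have hne' : z i ^ 2 + z k ^ 2 ≠ 0 := by positivity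
  have he : 1 + (z j * z k / (z i * rho z)) ^ 2 =
      (z i ^ 2 + z j ^ 2) * (z i ^ 2 + z k ^ 2) / (z i * rho z) ^ 2 := by
    field_simp; rw [hs]; ring
  rw [he]
  field_simp
  rw [hs]; ring

end Derivatives

/-! ### Continuity of the elementary terms. -/

section Continuity

theorem continuousAt_artanhTerm {i j : Fin 3} (hij : i ≠ j) {z : Fin 3 → ℝ} (hi : z i ≠ 0) :
    ContinuousAt (artanhTerm j) z := by
  refine ContinuousAt.comp (f := fun z : Fin 3 → ℝ => z j / rho z)
    (continuousAt_artanh (div_rho_mem_Ioo hij hi)) ?_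
  exact (continuous_apply j).continuousAt.div continuous_rho.continuousAt (rho_pos hi).ne'

theorem continuousAt_arctanTerm {i j k : Fin 3} {z : Fin 3 → ℝ} (hi : z i ≠ 0) :
    ContinuousAt (arctanTerm i j k) z := by
  have hp := rho_pos hi
  refine Real.continuous_arctan.continuousAt.comp
    (f := fun z : Fin 3 → ℝ => z j * z k / (z i * rho z)) ?_
  refine ContinuousAt.div (by fun_prop) ?_ (mul_ne_zero hi hp.ne')
  exact (continuous_apply i).continuousAt.mul continuous_rho.continuousAt

/-- Since `(1 + x)/(1 - x) = (1 + x)²/(1 - x²) ≤ (2/y)²`, the growth is logarithmic in `1/y`. The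
weaker square root bound suffices: a factor of order `y` still forces the product to `0`. -/
theorem abs_artanh_le {x y : ℝ} (hx : x ∈ Set.Ioo (-1 : ℝ) 1) (hy : 0 < y)
    (hxy : y ^ 2 ≤ 1 - x ^ 2) : |Real.artanh x| ≤ 2 * Real.sqrt (2 / y) := by
  have h1 : 0 < 1 + x := by linarith [hx.1]
  have h2 : 0 < 1 - x := by linarith [hx.2]
  have key : ∀ u : ℝ, 0 < u → u ≤ (2 / y) ^ 2 → 1 / 2 * Real.log u ≤ 2 * Real.sqrt (2 / y) := by
    intro u hu hle
    have h3 : Real.log u ≤ 4 * Real.log (Real.sqrt (2 / y)) := by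
      calc Real.log u ≤ Real.log ((2 / y) ^ 2) := Real.log_le_log hu hle
        _ = _ := by
          rw [Real.log_pow, Real.log_sqrt (by positivity)]; push_cast; ring
    have h4 := Real.log_le_sub_one_of_pos (show 0 < Real.sqrt (2 / y) by positivity)
    linarith
  have e1 : (1 + x) / (1 - x) ≤ (2 / y) ^ 2 := by
    rw [div_pow, div_le_div_iff₀ h2 (by positivity)]
    nlinarith [hx.1, hx.2]
  have e2 : (1 - x) / (1 + x) ≤ (2 / y) ^ 2 := by
    rw [div_pow, div_le_div_iff₀ h1 (by positivity)]
    nlinarith [hx.1, hx.2]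
  rw [Real.artanh_eq_half_log ⟨hx.1.le, hx.2.le⟩, abs_le]
  constructor
  · have := key _ (by positivity) e2
    rw [← inv_div (1 + x) (1 - x), Real.log_inv] at this
    linarith
  · exact key _ (by positivity) e1

theorem abs_mul_artanhTerm_le {i j : Fin 3} (hij : i ≠ j) (z : Fin 3 → ℝ) :
    |z i * artanhTerm j z| ≤ 2 * Real.sqrt (2 * rho z * |z i|) := by
  by_cases hi : z i = 0
  · simp [hi]
  have hp := rho_pos hi
  have ha : 0 < |z i| := abs_pos.mpr hi
  obtain ⟨k, h⟩ := exists_isTriple_of_ne hij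
  have hb := abs_artanh_le (y := |z i| / rho z) (div_rho_mem_Ioo hij hi) (by positivity) (by
    have hs := rho_sq h z
    rw [div_pow, div_pow, sq_abs, le_sub_iff_add_le, ← add_div, div_le_one (by positivity), hs]
    nlinarith [sq_nonneg (z k)])
  rw [abs_mul]
  calc |z i| * |artanhTerm j z| ≤ |z i| * (2 * Real.sqrt (2 / (|z i| / rho z))) := by
        gcongr; exact hb
    _ = 2 * (|z i| * Real.sqrt (2 / (|z i| / rho z))) := by ring
    _ = 2 * Real.sqrt (2 * rho z * |z i|) := by
        congr 1
        rw [show 2 * rho z * |z i| = |z i| ^ 2 * (2 / (|z i| / rho z)) by field_simp,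
          Real.sqrt_mul (by positivity), Real.sqrt_sq ha.le]

/-- Where `z_i = 0`, the bound `2 √(2 ρ |z_i|)` squeezes the product to `0`, including at the origin
and on the axis where `z_j/ρ = ±1`. -/
theorem continuous_mul_artanhTerm {i j : Fin 3} (hij : i ≠ j) :
    Continuous fun z : Fin 3 → ℝ => z i * artanhTerm j z := by
  rw [continuous_iff_continuousAt]
  intro z
  by_cases hi : z i = 0
  · have hz : z i * artanhTerm j z = 0 := by simp [hi]
    rw [ContinuousAt, hz]
    refine squeeze_zero_norm (a := fun z : Fin 3 → ℝ => 2 * Real.sqrt (2 * rho z * |z i|))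
      (fun z => abs_mul_artanhTerm_le hij z) ?_
    have hc : Continuous fun z : Fin 3 → ℝ => 2 * Real.sqrt (2 * rho z * |z i|) := by
      have := continuous_rho
      fun_prop
    simpa [hi] using hc.tendsto z
  · exact (continuous_apply i).continuousAt.mul (continuousAt_artanhTerm hij hi)

theorem continuous_mul_arctanTerm (i j k : Fin 3) :
    Continuous fun z : Fin 3 → ℝ => z i * arctanTerm i j k z := by
  rw [continuous_iff_continuousAt]
  intro z
  by_cases hi : z i = 0
  · have hz : z i * arctanTerm i j k z = 0 := by simp [hi]
    rw [ContinuousAt, hz]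
    refine squeeze_zero_norm (a := fun z : Fin 3 → ℝ => |z i| * (Real.pi / 2)) (fun z => ?_) ?_
    · rw [Real.norm_eq_abs, abs_mul]
      gcongr
      exact abs_le.mpr ⟨(Real.neg_pi_div_two_lt_arctan _).le, (Real.arctan_lt_pi_div_two _).le⟩
    · have hc : Continuous fun z : Fin 3 → ℝ => |z i| * (Real.pi / 2) := by fun_prop
      simpa [hi] using hc.tendsto z
  · exact (continuous_apply i).continuousAt.mul (continuousAt_arctanTerm hi)

end Continuity

/-! ### Spans of terms over the polynomials in two points -/

/-- Names of the coordinates of a pair of points `x`, `y`. -/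
abbrev PairVar : Type := Fin 3 ⊕ Fin 3

/-- The difference `x - y` of a pair of points. -/
noncomputable def diff (w : PairVar → ℝ) : Fin 3 → ℝ := fun i => w (Sum.inl i) - w (Sum.inr i)

/-- The functions of a pair of points `x`, `y` that are linear combinations of the functions
`g (x - y)`, `g ∈ S`, with rational polynomials in `x`, `y` as coefficients. -/
noncomputable def polySpan (S : Set ((Fin 3 → ℝ) → ℝ)) : Submodule ℚ ((PairVar → ℝ) → ℝ) :=
  Submodule.span ℚ {f | ∃ P : MvPolynomial PairVar ℚ, ∃ g ∈ S,
    f = fun w => MvPolynomial.aeval w P * g (diff w)}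

section PolySpan

variable {S : Set ((Fin 3 → ℝ) → ℝ)}

theorem aeval_mul_comp_diff_mem (P : MvPolynomial PairVar ℚ) {g : (Fin 3 → ℝ) → ℝ} (hg : g ∈ S) :
    (fun w => MvPolynomial.aeval w P * g (diff w)) ∈ polySpan S :=
  Submodule.subset_span ⟨P, g, hg, rfl⟩

theorem comp_diff_mem {g : (Fin 3 → ℝ) → ℝ} (hg : g ∈ S) :
    (fun w => g (diff w)) ∈ polySpan S := by
  simpa using aeval_mul_comp_diff_mem 1 hg

theorem aeval_mul_mem (P : MvPolynomial PairVar ℚ) {f : (PairVar → ℝ) → ℝ}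
    (hf : f ∈ polySpan S) : (fun w => MvPolynomial.aeval w P * f w) ∈ polySpan S := by
  induction hf using Submodule.span_induction with
  | mem f hf =>
    obtain ⟨P', g, hg, rfl⟩ := hf
    refine Submodule.subset_span ⟨P * P', g, hg, ?_⟩
    funext w
    rw [map_mul, mul_assoc]
  | zero => exact (congrArg (· ∈ polySpan S) (by funext w; simp)).mp (polySpan S).zero_mem
  | add f₁ f₂ _ _ h₁ h₂ =>
    refine (congrArg (· ∈ polySpan S) ?_).mp (add_mem h₁ h₂)
    funext w; simp [mul_add]
  | smul c f _ h =>
    refine (congrArg (· ∈ polySpan S) ?_).mp ((polySpan S).smul_mem c h)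
    funext w; simp [Rat.smul_def]; ring

theorem coord_mul_mem (u : PairVar) {f : (PairVar → ℝ) → ℝ} (hf : f ∈ polySpan S) :
    (fun w => w u * f w) ∈ polySpan S := by
  simpa using aeval_mul_mem (MvPolynomial.X u) hf

theorem diff_pow_mul_mem (i : Fin 3) (p : ℕ) {f : (PairVar → ℝ) → ℝ} (hf : f ∈ polySpan S) :
    (fun w => diff w i ^ p * f w) ∈ polySpan S := by
  refine (congrArg (· ∈ polySpan S) ?_).mp
    (aeval_mul_mem ((MvPolynomial.X (Sum.inl i) - MvPolynomial.X (Sum.inr i)) ^ p) hf)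
  funext w
  rw [map_pow, map_sub, MvPolynomial.aeval_X, MvPolynomial.aeval_X]
  rfl

theorem polySpan_mono {T : Set ((Fin 3 → ℝ) → ℝ)} (h : S ⊆ T) : polySpan S ≤ polySpan T :=
  Submodule.span_mono fun _ ⟨P, g, hg, hf⟩ => ⟨P, g, h hg, hf⟩

end PolySpan

/-- The terms from which the continuous antiderivatives are built. -/
inductive IsRegularTerm : ((Fin 3 → ℝ) → ℝ) → Prop
  | rho : IsRegularTerm Cuboid.rho
  | artanh {i j : Fin 3} (h : i ≠ j) : IsRegularTerm fun z => z i * artanhTerm j z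
  | arctan {i j k : Fin 3} (h : IsTriple i j k) : IsRegularTerm fun z => z i * arctanTerm i j k z

/-- The set of regular terms. -/
def regularTerms : Set ((Fin 3 → ℝ) → ℝ) := {g | IsRegularTerm g}

/-- Pairs of points that differ in each coordinate. -/
def generic : Set (PairVar → ℝ) := {w | ∀ i, diff w i ≠ 0}

/-- The index in `Fin 3` of a coordinate of a pair of points. -/
def axis : PairVar → Fin 3 := Sum.elim id id

/-! ### Antiderivatives along one of the six coordinates. -/

theorem diff_update (w : PairVar → ℝ) (v : PairVar) (t : ℝ) :
    diff (update w v t) = update (diff w) (axis v) (diff (update w v t) (axis v)) := by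
  funext l
  rcases v with i | i <;> by_cases h : l = i <;> simp [diff, axis, h, update_apply]

theorem hasDerivAt_comp_diff {φ ψ : (Fin 3 → ℝ) → ℝ} {v : PairVar} {w : PairVar → ℝ}
    (h : HasDerivAt (fun t => φ (update (diff w) (axis v) t)) (ψ (diff w)) (diff w (axis v))) :
    HasDerivAt (fun t => φ (diff (update w v t)))
      ((v.elim (fun _ => (1 : ℝ)) fun _ => -1) * ψ (diff w)) (w v) := by
  have hc : HasDerivAt (fun t => diff (update w v t) (axis v))
      (v.elim (fun _ => (1 : ℝ)) fun _ => -1) (w v) := by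
    rcases v with i | i
    · simpa [diff, axis] using (hasDerivAt_id (w (Sum.inl i))).sub_const (w (Sum.inr i))
    · simpa [diff, axis] using (hasDerivAt_id (w (Sum.inr i))).const_sub (w (Sum.inl i))
  have h' : HasDerivAt (fun t => φ (update (diff w) (axis v) t)) (ψ (diff w))
      (diff (update w v (w v)) (axis v)) := by rwa [update_eq_self]
  have := h'.comp (w v) hc
  rw [mul_comm]
  refine this.congr_of_eventuallyEq (Filter.Eventually.of_forall fun t => ?_)
  simp only [comp_apply]
  rw [← diff_update]

/-- The functions that have an antiderivative with respect to the coordinate `v` in `N`, where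
generic pairs of points only are considered. -/
noncomputable def primitive (v : PairVar) (N : Submodule ℚ ((PairVar → ℝ) → ℝ)) :
    Submodule ℚ ((PairVar → ℝ) → ℝ) where
  carrier := {f | ∃ F ∈ N, ∀ w ∈ generic, HasDerivAt (fun t => F (update w v t)) (f w) (w v)}
  add_mem' := by
    rintro f g ⟨F, hF, h⟩ ⟨G, hG, h'⟩
    exact ⟨F + G, add_mem hF hG, fun w hw => (h w hw).add (h' w hw)⟩
  zero_mem' := ⟨0, N.zero_mem, fun w _ => hasDerivAt_const _ _⟩
  smul_mem' := by
    rintro c f ⟨F, hF, h⟩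
    refine ⟨c • F, N.smul_mem c hF, fun w hw => ?_⟩
    simpa [Rat.smul_def] using (h w hw).const_mul (c : ℝ)

theorem primitive_congr {v : PairVar} {N : Submodule ℚ ((PairVar → ℝ) → ℝ)}
    {f g : (PairVar → ℝ) → ℝ} (hf : f ∈ primitive v N) (h : ∀ w ∈ generic, g w = f w) :
    g ∈ primitive v N := by
  obtain ⟨F, hF, hd⟩ := hf
  exact ⟨F, hF, fun w hw => by rw [h w hw]; exact hd w hw⟩

theorem const_mul_mem_primitive {v : PairVar} {N : Submodule ℚ ((PairVar → ℝ) → ℝ)}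
    {f : (PairVar → ℝ) → ℝ} (hf : f ∈ primitive v N) (c : ℚ) :
    (fun w => (c : ℝ) * f w) ∈ primitive v N :=
  primitive_congr ((primitive v N).smul_mem c hf) fun w _ => by simp [Rat.smul_def]

theorem comp_diff_mem_primitive {v : PairVar} {N : Submodule ℚ ((PairVar → ℝ) → ℝ)}
    {φ ψ : (Fin 3 → ℝ) → ℝ} (hφ : (fun w => φ (diff w)) ∈ N)
    (h : ∀ z : Fin 3 → ℝ, (∀ l, z l ≠ 0) →
      HasDerivAt (fun t => φ (update z (axis v) t)) (ψ z) (z (axis v))) :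
    (fun w => ψ (diff w)) ∈ primitive v N := by
  -- The sign compensates the inner derivative of `x - y`, which is `-1` along a coordinate of `y`.
  refine ⟨(v.elim (fun _ => (1 : ℚ)) fun _ => -1) • fun w => φ (diff w), N.smul_mem _ hφ,
    fun w hw => ?_⟩
  have hd := hasDerivAt_comp_diff (h (diff w) hw)
  rcases v with i | i
  · simpa using hd
  · simpa using hd.fun_neg

/-! ### Recursions and integration by parts for the terms. -/

section Primitives

variable {S : Set ((Fin 3 → ℝ) → ℝ)} {v : PairVar} {f : (PairVar → ℝ) → ℝ}

theorem coord_mul_mem_primitive {u : PairVar} (hu : u ≠ v) (hf : f ∈ primitive v (polySpan S)) :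
    (fun w => w u * f w) ∈ primitive v (polySpan S) := by
  obtain ⟨F, hF, hd⟩ := hf
  refine ⟨_, coord_mul_mem u hF, fun w hw => ?_⟩
  simpa [update_of_ne hu] using (hd w hw).const_mul (w u)

theorem diff_mul_mem_primitive {l : Fin 3} (hl : l ≠ axis v)
    (hf : f ∈ primitive v (polySpan S)) :
    (fun w => diff w l * f w) ∈ primitive v (polySpan S) := by
  have h1 : Sum.inl l ≠ v := by rintro rfl; exact hl rfl
  have h2 : Sum.inr l ≠ v := by rintro rfl; exact hl rfl
  refine primitive_congr (sub_mem (coord_mul_mem_primitive h1 hf)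
    (coord_mul_mem_primitive h2 hf)) fun w _ => ?_
  simp [diff, sub_mul]

/-- Integration by parts: `(p + 1) z^p g = (z^(p+1) g)' - z^(p+1) g'`. The raised power supplies the
factor that regular terms need. -/
theorem pow_mul_mem_primitive_of_byParts {g g' : (Fin 3 → ℝ) → ℝ} (p : ℕ)
    (hg : ∀ z : Fin 3 → ℝ, (∀ l, z l ≠ 0) →
      HasDerivAt (fun t => g (update z (axis v) t)) (g' z) (z (axis v)))
    (h₁ : (fun w => diff w (axis v) ^ (p + 1) * g (diff w)) ∈ polySpan S)
    (h₂ : (fun w => diff w (axis v) ^ (p + 1) * g' (diff w)) ∈ primitive v (polySpan S)) :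
    (fun w => diff w (axis v) ^ p * g (diff w)) ∈ primitive v (polySpan S) := by
  have h := comp_diff_mem_primitive (v := v)
    (φ := fun z => z (axis v) ^ (p + 1) * g z)
    (ψ := fun z => ((p + 1 : ℕ) : ℝ) * z (axis v) ^ p * g z + z (axis v) ^ (p + 1) * g' z)
    h₁ (fun z hz => by
      simpa using (hasDerivAt_pow (p + 1) (z (axis v))).fun_mul (hg z hz))
  refine primitive_congr (const_mul_mem_primitive (sub_mem h h₂) (((p + 1 : ℕ) : ℚ)⁻¹))
    fun w _ => ?_
  have : (p : ℝ) + 1 ≠ 0 := by positivity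
  simp only [Pi.sub_apply]
  push_cast
  field_simp
  ring

variable {i j k : Fin 3}

theorem div_rho_mem_primitive (hS : regularTerms ⊆ S) (hv : axis v = i) (h : IsTriple i j k) :
    (fun w => diff w j / rho (diff w)) ∈ primitive v (polySpan S) := by
  subst hv
  refine comp_diff_mem_primitive (φ := fun z => z j * artanhTerm (axis v) z)
    (ψ := fun z => z j / rho z) (comp_diff_mem (hS (.artanh h.1.symm))) fun z hz => ?_
  have := (hasDerivAt_artanhTerm_self h (hz j)).const_mul (z j)
  simpa [update_of_ne h.1.symm, div_eq_mul_inv] using this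

/-- With `s = z_j² + z_k²`, differentiating `z_i^(p+1) ρ` gives `(p + 2) z_i^(p+2)/ρ + (p + 1) s
z_i^p/ρ`. The second claim is carried along because the recursion reaches `s/ρ`, whereas `1/ρ` alone
has the antiderivative `artanh(z_i/ρ)`, which lacks a regularizing factor. -/
theorem pow_div_rho_mem_primitive (hS : regularTerms ⊆ S) (hv : axis v = i)
    (h : IsTriple i j k) (p : ℕ) :
    (fun w => diff w i ^ (p + 1) / rho (diff w)) ∈ primitive v (polySpan S) ∧
      (fun w => (diff w j ^ 2 + diff w k ^ 2) * (diff w i ^ p / rho (diff w))) ∈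
        primitive v (polySpan S) := by
  have aux : ∀ q, (fun w => diff w i ^ q / rho (diff w)) ∈ primitive v (polySpan S) →
      (fun w => (diff w j ^ 2 + diff w k ^ 2) * (diff w i ^ q / rho (diff w))) ∈
        primitive v (polySpan S) := fun q hq => by
    have hj := hv.symm ▸ h.1.symm
    have hk := hv.symm ▸ h.2.2.symm
    refine primitive_congr (add_mem
      (diff_mul_mem_primitive hj (diff_mul_mem_primitive hj hq))
      (diff_mul_mem_primitive hk (diff_mul_mem_primitive hk hq))) fun w _ => ?_
    simp only [Pi.add_apply]
    ring
  induction p using Nat.strong_induction_on with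
  | _ p ih =>
  have h2 : (fun w => (diff w j ^ 2 + diff w k ^ 2) * (diff w i ^ p / rho (diff w))) ∈
      primitive v (polySpan S) := by
    rcases p with _ | p
    · refine primitive_congr (add_mem
        (diff_mul_mem_primitive (hv.symm ▸ h.1.symm) (div_rho_mem_primitive hS hv h))
        (diff_mul_mem_primitive (hv.symm ▸ h.2.2.symm)
          (div_rho_mem_primitive hS hv h.swap))) fun w _ => ?_
      simp only [Pi.add_apply]
      ring
    · exact aux _ (ih p (Nat.lt_succ_self p)).1
  refine ⟨?_, h2⟩
  have hd := comp_diff_mem_primitive (v := v) (N := polySpan S)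
    (φ := fun z => z i ^ p * rho z)
    (ψ := fun z => (p : ℝ) * z i ^ (p - 1) * rho z + z i ^ p * (z i / rho z))
    (diff_pow_mul_mem i p (comp_diff_mem (hS .rho))) (fun z hz => by
      subst hv
      simpa using (hasDerivAt_pow p (z (axis v))).fun_mul
        (hasDerivAt_rho (i := axis v) (rho_pos (hz j)).ne'))
  rcases p with _ | p
  · refine primitive_congr hd fun w _ => ?_
    simp
  · have h3 := (ih p (Nat.lt_succ_self p)).2
    refine primitive_congr (const_mul_mem_primitive
      (sub_mem hd (const_mul_mem_primitive h3 ((p + 1 : ℕ) : ℚ))) (((p + 2 : ℕ) : ℚ)⁻¹))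
      fun w hw => ?_
    have hr := (rho_pos (hw i)).ne'
    have hs := rho_sq h (diff w)
    have : (p : ℝ) + 2 ≠ 0 := by positivity
    simp only [Pi.sub_apply, Nat.add_sub_cancel]
    push_cast
    field_simp
    rw [hs]
    ring

theorem pow_mul_div_rho_mem_primitive (hS : regularTerms ⊆ S) (hv : axis v = i)
    (h : IsTriple i j k) (p : ℕ) :
    (fun w => diff w j * (diff w i ^ p / rho (diff w))) ∈ primitive v (polySpan S) := by
  rcases p with _ | p
  · refine primitive_congr (div_rho_mem_primitive hS hv h) fun w _ => ?_
    ring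
  · exact diff_mul_mem_primitive (hv.symm ▸ h.1.symm) (pow_div_rho_mem_primitive hS hv h p).1

theorem sq_mul_kernel_mem_primitive (hS : regularTerms ⊆ S) (hv : axis v = i)
    (h : IsTriple i j k) :
    (fun w => diff w k ^ 2 *
      (diff w j / (rho (diff w) * (diff w i ^ 2 + diff w k ^ 2)))) ∈
        primitive v (polySpan S) := by
  subst hv
  have := comp_diff_mem_primitive (v := v) (φ := fun z => z k * arctanTerm k (axis v) j z)
    (ψ := fun z => z k * (z k * z j / (rho z * (z (axis v) ^ 2 + z k ^ 2))))
    (comp_diff_mem (hS (.arctan h.rotate.rotate))) fun z hz => by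
      simpa [update_of_ne h.2.2.symm] using
        (hasDerivAt_arctanTerm_of_ne h.swap (hz k)).const_mul (z k)
  refine primitive_congr this fun w _ => ?_
  ring

theorem mul_kernel_mem_primitive (hS : regularTerms ⊆ S) (hv : axis v = i)
    (h : IsTriple i j k) :
    (fun w => diff w k * (diff w i *
      (diff w j / (rho (diff w) * (diff w i ^ 2 + diff w k ^ 2))))) ∈
        primitive v (polySpan S) := by
  subst hv
  have := comp_diff_mem_primitive (v := v) (φ := fun z => z k * artanhTerm j z)
    (ψ := fun z => z k * (-(z (axis v) * z j / (rho z * (z (axis v) ^ 2 + z k ^ 2)))))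
    (comp_diff_mem (hS (.artanh h.2.1.symm))) fun z hz => by
      simpa [update_of_ne h.2.2.symm] using
        (hasDerivAt_artanhTerm_of_ne h (hz k)).const_mul (z k)
  refine primitive_congr (neg_mem this) fun w _ => ?_
  simp only [Pi.neg_apply]
  ring

/-- Writing `z_i² = (z_i² + z_k²) - z_k²` cancels the denominator in one part and lowers the power
by two in the other. The recursion ends at powers `0` and `1`, whose antiderivatives are an arctan
and an artanh; the factor `z_k²` makes both regular. -/
theorem pow_mul_kernel_mem_primitive (hS : regularTerms ⊆ S) (hv : axis v = i)
    (h : IsTriple i j k) (p : ℕ) :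
    (fun w => diff w i ^ (p + 2) *
      (diff w j / (rho (diff w) * (diff w i ^ 2 + diff w k ^ 2)))) ∈
        primitive v (polySpan S) := by
  have hk : k ≠ axis v := hv.symm ▸ h.2.2.symm
  induction p using Nat.strong_induction_on with
  | _ p ih =>
  have h2 : (fun w => diff w k ^ 2 * (diff w i ^ p *
      (diff w j / (rho (diff w) * (diff w i ^ 2 + diff w k ^ 2))))) ∈
        primitive v (polySpan S) := by
    rcases p with _ | _ | p
    · simpa using sq_mul_kernel_mem_primitive hS hv h
    · refine primitive_congr (diff_mul_mem_primitive hk (mul_kernel_mem_primitive hS hv h))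
        fun w _ => ?_
      ring
    · refine primitive_congr (diff_mul_mem_primitive hk (diff_mul_mem_primitive hk
        (ih p (by omega)))) fun w _ => ?_
      ring
  refine primitive_congr (sub_mem (pow_mul_div_rho_mem_primitive hS hv h p) h2) fun w hw => ?_
  have hr := (rho_pos (hw i)).ne'
  have hne : diff w i ^ 2 + diff w k ^ 2 ≠ 0 := by
    have := hw i
    positivity
  simp only [Pi.sub_apply]
  field_simp
  ring

theorem pow_mul_artanhTerm_mem_primitive (hS : regularTerms ⊆ S) (hv : axis v = i)
    (h : IsTriple i j k) (p : ℕ) :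
    (fun w => diff w i ^ p * artanhTerm j (diff w)) ∈ primitive v (polySpan S) := by
  subst hv
  refine pow_mul_mem_primitive_of_byParts p
    (fun z hz => hasDerivAt_artanhTerm_of_ne h (hz k)) ?_ ?_
  · refine (congrArg (· ∈ polySpan S) ?_).mp
      (diff_pow_mul_mem (axis v) p (comp_diff_mem (hS (.artanh h.1))))
    funext w; ring
  · refine primitive_congr (neg_mem (pow_mul_kernel_mem_primitive hS rfl h p)) fun w _ => ?_
    simp only [Pi.neg_apply]
    ring

theorem pow_mul_arctanTerm_self_mem_primitive (hS : regularTerms ⊆ S) (hv : axis v = i)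
    (h : IsTriple i j k) (p : ℕ) :
    (fun w => diff w i ^ (p + 1) * arctanTerm i j k (diff w)) ∈ primitive v (polySpan S) := by
  subst hv
  refine pow_mul_mem_primitive_of_byParts (p + 1)
    (fun z hz => hasDerivAt_arctanTerm_self h (hz _) (hz _) (hz _)) ?_ ?_
  · refine (congrArg (· ∈ polySpan S) ?_).mp
      (diff_pow_mul_mem (axis v) (p + 1) (comp_diff_mem (hS (.arctan h))))
    funext w; ring
  · refine primitive_congr (neg_mem (add_mem
      (diff_mul_mem_primitive h.1.symm (pow_mul_kernel_mem_primitive hS rfl h.swap p))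
      (diff_mul_mem_primitive h.2.2.symm (pow_mul_kernel_mem_primitive hS rfl h p))))
      fun w _ => ?_
    simp only [Pi.neg_apply, Pi.add_apply]
    ring

/-- Integration by parts keeps the regularizing factor `z_k`, and the derivative of the arctan
contributes another one. For `p = 0` the remaining power of `z_i` is `1`, below the range of
`pow_mul_kernel_mem_primitive`, so `mul_kernel_mem_primitive` is used. -/
theorem pow_mul_arctanTerm_of_ne_mem_primitive (hS : regularTerms ⊆ S) (hv : axis v = i)
    (h : IsTriple i j k) (p : ℕ) :
    (fun w => diff w i ^ p * (diff w k * arctanTerm k i j (diff w))) ∈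
      primitive v (polySpan S) := by
  subst hv
  refine pow_mul_mem_primitive_of_byParts (g := fun z => z k * arctanTerm k (axis v) j z)
    (g' := fun z => z k * (z k * z j / (rho z * (z (axis v) ^ 2 + z k ^ 2)))) p
    (fun z hz => ?_) ?_ ?_
  · simpa [update_of_ne h.2.2.symm] using
      (hasDerivAt_arctanTerm_of_ne h.swap (hz k)).const_mul (z k)
  · exact diff_pow_mul_mem _ _ (comp_diff_mem (hS (.arctan h.rotate.rotate)))
  · rcases p with _ | p
    · refine primitive_congr (diff_mul_mem_primitive h.2.2.symm
        (mul_kernel_mem_primitive hS rfl h)) fun w _ => ?_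
      ring
    · refine primitive_congr (diff_mul_mem_primitive h.2.2.symm (diff_mul_mem_primitive h.2.2.symm
        (pow_mul_kernel_mem_primitive hS rfl h p))) fun w _ => ?_
      ring

theorem pow_mul_regularTerm_mem_primitive (hS : regularTerms ⊆ S) {g : (Fin 3 → ℝ) → ℝ}
    (hg : IsRegularTerm g) (p : ℕ) :
    (fun w => diff w (axis v) ^ p * g (diff w)) ∈ primitive v (polySpan S) := by
  cases hg with
  | rho =>
    obtain ⟨j, k, h⟩ := exists_isTriple (axis v)
    -- Here `ρ = ρ²/ρ` is split by `ρ² = z_i² + (z_j² + z_k²)`.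
    refine primitive_congr (add_mem (pow_div_rho_mem_primitive hS rfl h (p + 1)).1
      (pow_div_rho_mem_primitive hS rfl h p).2) fun w hw => ?_
    have hr := (rho_pos (hw j)).ne'
    have hs := rho_sq h (diff w)
    simp only [Pi.add_apply]
    field_simp
    rw [hs]
    ring
  | @artanh l m hlm =>
    by_cases hm : m = axis v
    · subst hm
      obtain ⟨k, h⟩ := exists_isTriple_of_ne hlm.symm
      refine pow_mul_mem_primitive_of_byParts (g := fun z => z l * artanhTerm (axis v) z)
        (g' := fun z => z l * (1 / rho z)) p (fun z hz => ?_) ?_ ?_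
      · simpa [update_of_ne hlm] using (hasDerivAt_artanhTerm_self h (hz l)).const_mul (z l)
      · exact diff_pow_mul_mem _ _ (comp_diff_mem (hS (.artanh hlm)))
      · refine primitive_congr (pow_mul_div_rho_mem_primitive hS rfl h (p + 1)) fun w _ => ?_
        ring
    · obtain ⟨k, h⟩ := exists_isTriple_of_ne (Ne.symm hm)
      by_cases hl : l = axis v
      · subst hl
        refine primitive_congr (pow_mul_artanhTerm_mem_primitive hS rfl h (p + 1)) fun w _ => ?_
        ring
      · refine primitive_congr (diff_mul_mem_primitive hl
          (pow_mul_artanhTerm_mem_primitive hS rfl h p)) fun w _ => ?_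
        ring
  | @arctan l m n h =>
    rcases h.eq_or (axis v) with hv | hv | hv
    · refine primitive_congr (pow_mul_arctanTerm_self_mem_primitive hS hv h p) fun w _ => ?_
      rw [hv]
      ring
    · refine primitive_congr (pow_mul_arctanTerm_of_ne_mem_primitive hS hv h.rotate p)
        fun w _ => ?_
      rw [hv]
    · refine primitive_congr (pow_mul_arctanTerm_of_ne_mem_primitive hS hv h.swap.rotate p)
        fun w _ => ?_
      rw [hv]
      simp only [arctanTerm, mul_comm]

theorem pow_mul_inv_rho_mem_primitive (hS : regularTerms ⊆ S) (hv : artanhTerm (axis v) ∈ S)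
    (p : ℕ) :
    (fun w => diff w (axis v) ^ p * (1 / rho (diff w))) ∈ primitive v (polySpan S) := by
  obtain ⟨j, k, h⟩ := exists_isTriple (axis v)
  rcases p with _ | p
  · simpa using comp_diff_mem_primitive (v := v) (φ := artanhTerm (axis v))
      (ψ := fun z => 1 / rho z) (comp_diff_mem hv)
      (fun z hz => hasDerivAt_artanhTerm_self h (hz j))
  · refine primitive_congr (pow_div_rho_mem_primitive hS rfl h p).1 fun w _ => ?_
    ring

/-- Along its own direction `z/ρ³` is the derivative of `-1/ρ`; integration by parts reduces the
power to the case of the potential. -/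
theorem pow_mul_div_rho_cube_mem_primitive (hS : regularTerms ⊆ S)
    (hv : artanhTerm (axis v) ∈ S) (hr : (fun z => 1 / rho z) ∈ S) (p : ℕ) :
    (fun w => diff w (axis v) ^ p * (diff w (axis v) / rho (diff w) ^ 3)) ∈
      primitive v (polySpan S) := by
  have hd := comp_diff_mem_primitive (v := v) (N := polySpan S)
    (φ := fun z => z (axis v) ^ p * (1 / rho z))
    (ψ := fun z => (p : ℝ) * z (axis v) ^ (p - 1) * (1 / rho z) +
      z (axis v) ^ p * (-(z (axis v) / rho z ^ 3)))
    (diff_pow_mul_mem (axis v) p (comp_diff_mem hr)) (fun z hz => by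
      simpa using (hasDerivAt_pow p (z (axis v))).fun_mul
        (hasDerivAt_inv_rho (i := axis v) (rho_pos (hz 0)).ne'))
  -- For `p = 0` the truncated exponent `p - 1` is harmless, as its coefficient `p` vanishes.
  refine primitive_congr (sub_mem (const_mul_mem_primitive
    (pow_mul_inv_rho_mem_primitive hS hv (p - 1)) p) hd) fun w _ => ?_
  simp only [Pi.sub_apply]
  push_cast
  ring

/-- Coordinates other than `v` are constants, and `v` itself is plus or minus the difference `x_i -
y_i` plus such a constant. The induction therefore carries an arbitrary power of the difference,
raised by each factor `v`. -/
theorem aeval_mul_mem_primitive {g : (Fin 3 → ℝ) → ℝ}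
    (hg : ∀ p : ℕ, (fun w => diff w (axis v) ^ p * g (diff w)) ∈ primitive v (polySpan S))
    (P : MvPolynomial PairVar ℚ) :
    (fun w => MvPolynomial.aeval w P * g (diff w)) ∈ primitive v (polySpan S) := by
  suffices H : ∀ p : ℕ, (fun w => diff w (axis v) ^ p * MvPolynomial.aeval w P * g (diff w)) ∈
      primitive v (polySpan S) by simpa using H 0
  induction P using MvPolynomial.induction_on with
  | C c =>
    intro p
    refine primitive_congr (const_mul_mem_primitive (hg p) c) fun w _ => ?_
    simp
    ring
  | add P Q hP hQ =>
    intro p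
    refine primitive_congr (add_mem (hP p) (hQ p)) fun w _ => ?_
    simp only [map_add, Pi.add_apply]
    ring
  | mul_X P u hP =>
    intro p
    by_cases hu : u = v
    · subst hu
      rcases u with i | i
      · refine primitive_congr (add_mem (hP (p + 1))
          (coord_mul_mem_primitive (u := Sum.inr i) (by simp) (hP p))) fun w _ => ?_
        simp only [map_mul, MvPolynomial.aeval_X, Pi.add_apply, axis, Sum.elim_inl, id, diff]
        ring
      · refine primitive_congr (sub_mem
          (coord_mul_mem_primitive (u := Sum.inl i) (by simp) (hP p)) (hP (p + 1))) fun w _ => ?_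
        simp only [map_mul, MvPolynomial.aeval_X, Pi.sub_apply, axis, Sum.elim_inr, id, diff]
        ring
    · refine primitive_congr (coord_mul_mem_primitive hu (hP p)) fun w _ => ?_
      simp only [map_mul, MvPolynomial.aeval_X]
      ring

theorem polySpan_le_primitive {T : Set ((Fin 3 → ℝ) → ℝ)}
    (h : ∀ g ∈ T, ∀ p : ℕ,
      (fun w => diff w (axis v) ^ p * g (diff w)) ∈ primitive v (polySpan S)) :
    polySpan T ≤ primitive v (polySpan S) := by
  refine Submodule.span_le.mpr ?_
  rintro _ ⟨P, g, hg, rfl⟩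
  exact aeval_mul_mem_primitive (h g hg) P

/-- Regular functions have regular antiderivatives. -/
theorem polySpan_regularTerms_le_primitive (v : PairVar) :
    polySpan regularTerms ≤ primitive v (polySpan regularTerms) :=
  polySpan_le_primitive fun _ hg => pow_mul_regularTerm_mem_primitive subset_rfl hg

end Primitives

/-! ### The fundamental theorem of calculus along a coordinate -/

/-- Continuity at all pairs of points that differ in at least two given coordinates. -/
def IsLineContinuous (f : (PairVar → ℝ) → ℝ) : Prop :=
  ∀ (i : Fin 3) (w : PairVar → ℝ), (∀ l, l ≠ i → diff w l ≠ 0) → ContinuousAt f w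

theorem continuous_diff : Continuous diff := by
  unfold diff; fun_prop

theorem continuous_aeval (P : MvPolynomial PairVar ℚ) :
    Continuous fun w : PairVar → ℝ => (MvPolynomial.aeval w P : ℝ) := by
  simp only [MvPolynomial.aeval_def, MvPolynomial.eval₂_eq_eval_map]
  exact MvPolynomial.continuous_eval _

theorem continuousAt_of_mem_polySpan {S : Set ((Fin 3 → ℝ) → ℝ)} {w : PairVar → ℝ}
    (hS : ∀ g ∈ S, ContinuousAt g (diff w)) {f : (PairVar → ℝ) → ℝ} (hf : f ∈ polySpan S) :
    ContinuousAt f w := by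
  induction hf using Submodule.span_induction with
  | mem f hf =>
    obtain ⟨P, g, hg, rfl⟩ := hf
    exact (continuous_aeval P).continuousAt.mul
      (ContinuousAt.comp (hS g hg) continuous_diff.continuousAt)
  | zero => exact continuousAt_const
  | add f₁ f₂ _ _ h₁ h₂ => exact h₁.add h₂
  | smul c f _ h =>
    have := h.const_mul (c : ℝ)
    refine this.congr (Filter.Eventually.of_forall fun w => ?_)
    simp [Rat.smul_def]

theorem IsRegularTerm.continuous {g : (Fin 3 → ℝ) → ℝ} (hg : IsRegularTerm g) :
    Continuous g := by
  cases hg with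
  | rho => exact continuous_rho
  | artanh h => exact continuous_mul_artanhTerm h
  | arctan h => exact continuous_mul_arctanTerm _ _ _

theorem continuous_of_mem_polySpan_regularTerms {f : (PairVar → ℝ) → ℝ}
    (hf : f ∈ polySpan regularTerms) : Continuous f :=
  continuous_iff_continuousAt.mpr fun _ =>
    continuousAt_of_mem_polySpan (fun _ hg => IsRegularTerm.continuous hg |>.continuousAt) hf

theorem diff_update_of_ne {l : Fin 3} {v : PairVar} (h : l ≠ axis v) (w : PairVar → ℝ) (t : ℝ) :
    diff (update w v t) l = diff w l := by
  rw [diff_update, update_of_ne h]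

theorem IsLineContinuous.continuous_update {f : (PairVar → ℝ) → ℝ} (hf : IsLineContinuous f)
    {v : PairVar} {w : PairVar → ℝ} (hw : ∀ l, l ≠ axis v → diff w l ≠ 0) :
    Continuous fun t => f (update w v t) := by
  rw [continuous_iff_continuousAt]
  intro t
  refine ContinuousAt.comp (f := fun t => update w v t) (hf (axis v) _ fun l hl => ?_) ?_
  · rw [diff_update_of_ne hl]
    exact hw l hl
  · exact (continuous_const.update v continuous_id).continuousAt

/-- The line leaves the generic pairs at no more than one point, where the difference along `v`
vanishes, and `F` is continuous there. -/
theorem integral_update_eq_sub {F f : (PairVar → ℝ) → ℝ} (hF : IsLineContinuous F)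
    (hf : IsLineContinuous f) {v : PairVar}
    (hd : ∀ w ∈ generic, HasDerivAt (fun t => F (update w v t)) (f w) (w v))
    {w : PairVar → ℝ} (hw : ∀ l, l ≠ axis v → diff w l ≠ 0) (a b : ℝ) :
    ∫ t in a..b, f (update w v t) = F (update w v b) - F (update w v a) := by
  refine integral_eq_of_hasDerivAt_off_countable (fun t => F (update w v t)) _
    (s := {t | diff (update w v t) (axis v) = 0}) ?_ (hF.continuous_update hw).continuousOn
    (fun t ht => ?_) ((hf.continuous_update hw).intervalIntegrable a b)
  · refine Set.Subsingleton.countable fun t ht t' ht' => ?_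
    rcases v with i | i
    · simp only [diff, axis, Set.mem_ofPred_eq, Sum.elim_inl, id, update_self, ne_eq, reduceCtorEq,
        not_false_eq_true, update_of_ne] at ht ht'
      linarith
    · simp only [diff, axis, Set.mem_ofPred_eq, Sum.elim_inr, id, update_self, ne_eq, reduceCtorEq,
        not_false_eq_true, update_of_ne] at ht ht'
      linarith
  · have hg : update w v t ∈ generic := by
      intro l
      by_cases hl : l = axis v
      · rw [hl]; exact ht.2
      · rw [diff_update_of_ne hl]; exact hw l hl
    simpa using hd _ hg

/-- Shifting `x` by `ε` in every coordinate makes all differences nonzero for small `ε ≠ 0`, so the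
preceding case applies. Both sides are continuous in `ε`. -/
theorem integral_update_eq_sub_of_continuous {F f : (PairVar → ℝ) → ℝ} (hF : Continuous F)
    (hf : Continuous f) {v : PairVar}
    (hd : ∀ w ∈ generic, HasDerivAt (fun t => F (update w v t)) (f w) (w v))
    (w : PairVar → ℝ) (a b : ℝ) :
    ∫ t in a..b, f (update w v t) = F (update w v b) - F (update w v a) := by
  let W : ℝ → PairVar → ℝ := fun ε u => w u + u.elim (fun _ => ε) fun _ => 0
  have hW : Continuous W := by
    refine continuous_pi fun u => ?_
    rcases u with i | i <;> simp only [W, Sum.elim_inl, Sum.elim_inr] <;> fun_prop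
  have hW0 : W 0 = w := by
    funext u
    rcases u with i | i <;> simp [W]
  have hdiff : ∀ ε l, diff (W ε) l = diff w l + ε := fun ε l => by
    simp only [diff, W, Sum.elim_inl, Sum.elim_inr]; ring
  have hev : ∀ᶠ ε in nhdsWithin (0 : ℝ) {0}ᶜ,
      ∫ t in a..b, f (update (W ε) v t) = F (update (W ε) v b) - F (update (W ε) v a) := by
    have h1 : ∀ l, ∀ᶠ ε in nhdsWithin (0 : ℝ) {0}ᶜ, diff w l + ε ≠ 0 := by
      intro l
      by_cases hl : diff w l = 0
      · filter_upwards [self_mem_nhdsWithin] with ε hε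
        simpa [hl] using hε
      · refine nhdsWithin_le_nhds ?_
        have hc : ContinuousAt (fun ε : ℝ => diff w l + ε) 0 := by fun_prop
        exact hc.eventually_ne (by simpa using hl)
    filter_upwards [Filter.eventually_all.mpr h1] with ε hε
    refine integral_update_eq_sub (fun _ _ _ => hF.continuousAt) (fun _ _ _ => hf.continuousAt)
      hd (fun l _ => ?_) a b
    rw [hdiff]
    exact hε l
  have hu : Continuous fun p : ℝ × ℝ => update (W p.1) v p.2 :=
    (hW.comp continuous_fst).update v continuous_snd
  have hL : Continuous fun ε => ∫ t in a..b, f (update (W ε) v t) :=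
    intervalIntegral.continuous_parametric_intervalIntegral_of_continuous'
      (f := fun ε t => f (update (W ε) v t)) (hf.comp hu) a b
  have hR : Continuous fun ε => F (update (W ε) v b) - F (update (W ε) v a) :=
    (hF.comp (hW.update v continuous_const)).sub (hF.comp (hW.update v continuous_const))
  have := tendsto_nhds_unique_of_eventuallyEq
    (hL.continuousAt.tendsto.mono_left nhdsWithin_le_nhds)
    (hR.continuousAt.tendsto.mono_left nhdsWithin_le_nhds) hev
  simpa only [hW0] using this

/-! ### Integration over a cuboid -/

/-- Integration over a cuboid, the coordinate `k` being the innermost one. -/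
theorem integral_Icc_eq_iterated (k : Fin 3) {a b : Fin 3 → ℝ} (hab : a ≤ b)
    {g : (Fin 3 → ℝ) → ℝ} (hg : IntegrableOn g (Set.Icc a b)) (y : Fin 3 → ℝ) :
    ∫ x in Set.Icc a b, g x =
      ∫ s in a (k.succAbove 1)..b (k.succAbove 1), ∫ t in a (k.succAbove 0)..b (k.succAbove 0),
        ∫ r in a k..b k,
          g (update (update (update y (k.succAbove 1) s) (k.succAbove 0) t) k r) := by
  let μ : Fin 3 → Measure ℝ := fun l => volume.restrict (Set.Icc (a l) (b l))
  have hμ : (volume : Measure (Fin 3 → ℝ)).restrict (Set.Icc a b) = Measure.pi μ := by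
    rw [← Set.pi_univ_Icc, volume_pi, Measure.restrict_pi_pi]
  have e₁ := (measurePreserving_piFinSuccAbove μ k).symm
  have e₂ := (measurePreserving_piFinTwo fun l => μ (k.succAbove l)).symm
  have e₃ := (MeasurePreserving.id (μ k)).prod e₂
  let T : ℝ × ℝ × ℝ → Fin 3 → ℝ := fun q =>
    update (update (update y (k.succAbove 1) q.2.2) (k.succAbove 0) q.2.1) k q.1
  have hT : ∀ q : ℝ × ℝ × ℝ, (MeasurableEquiv.piFinSuccAbove (fun _ : Fin 3 => ℝ) k).symm
      (Prod.map id (MeasurableEquiv.piFinTwo fun _ : Fin 2 => ℝ).symm q) = T q := by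
    rintro ⟨r, t, s⟩
    funext l
    simp only [MeasurableEquiv.piFinSuccAbove_symm_apply, T]
    fin_cases k <;> fin_cases l <;> rfl
  have e : MeasurePreserving T ((μ k).prod ((μ (k.succAbove 0)).prod (μ (k.succAbove 1))))
      (Measure.pi μ) := by
    have := e₁.comp e₃
    refine (congrArg (fun F => MeasurePreserving F _ _) ?_).mp this
    funext q
    exact hT q
  have hemb : MeasurableEmbedding T := by
    have h1 : MeasurableEmbedding (Prod.map id (MeasurableEquiv.piFinTwo fun _ : Fin 2 => ℝ).symm :
        ℝ × ℝ × ℝ → ℝ × (Fin 2 → ℝ)) :=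
      ((MeasurableEquiv.refl ℝ).prodCongr
        (MeasurableEquiv.piFinTwo fun _ : Fin 2 => ℝ).symm).measurableEmbedding
    have := (MeasurableEquiv.piFinSuccAbove (fun _ : Fin 3 => ℝ) k).symm.measurableEmbedding.comp h1
    refine (congrArg MeasurableEmbedding ?_).mp this
    funext q
    exact hT q
  have hInt : Integrable (fun q => g (T q))
      ((μ k).prod ((μ (k.succAbove 0)).prod (μ (k.succAbove 1)))) := by
    rw [IntegrableOn, hμ] at hg
    exact (e.integrable_comp_emb hemb).mpr hg
  have hI : ∀ (l : Fin 3) (h : ℝ → ℝ), ∫ t in a l..b l, h t = ∫ t, h t ∂(μ l) := fun l h => by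
    rw [intervalIntegral.integral_of_le (hab l), ← integral_Icc_eq_integral_Ioc]
  -- The coordinate `k` is the first factor of the product, so the symmetric form of Fubini makes it
  -- innermost.
  rw [hμ, ← e.integral_comp hemb, integral_prod_symm _ hInt,
    integral_prod_symm _ hInt.integral_prod_right]
  simp only [hI, T]

/-- The sign of an end point of an interval: `1` for the upper and `-1` for the lower one. -/
def endSign (c : Bool) : ℝ := if c then 1 else -1

/-- The function `g'` is an antiderivative of `g` along the `v`-th coordinate, between the bounds
`a v` and `b v` and on the lines whose remaining coordinates satisfy `p`. -/
def IsEdgePrimitive (p : Fin 3 → ℝ → Prop) (a b : Fin 3 → ℝ) (v : Fin 3)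
    (g g' : (Fin 3 → ℝ) → ℝ) : Prop :=
  ∀ y, (∀ l, l ≠ v → p l (y l)) →
    IntervalIntegrable (fun t => g (update y v t)) volume (a v) (b v) ∧
      ∫ t in a v..b v, g (update y v t) = g' (update y v (b v)) - g' (update y v (a v))

theorem IsEdgePrimitive.integral_eq {p : Fin 3 → ℝ → Prop} {a b : Fin 3 → ℝ} {v : Fin 3}
    {g g' : (Fin 3 → ℝ) → ℝ} (h : IsEdgePrimitive p a b v g g') {y : Fin 3 → ℝ}
    (hy : ∀ l, l ≠ v → p l (y l)) :
    ∫ t in a v..b v, g (update y v t) =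
      ∑ c, endSign c * g' (update y v (if c then b v else a v)) := by
  rw [(h y hy).2]
  simp [endSign]
  ring

theorem isTriple_succAbove (k : Fin 3) : IsTriple k (k.succAbove 0) (k.succAbove 1) := by
  unfold IsTriple; revert k; decide

/-- The vertex selection that takes the values `c`, `c'`, `c''` at `k`, `i`, `j`. -/
def selection (k i j : Fin 3) (c c' c'' : Bool) : Fin 3 → Bool :=
  update (update (update (fun _ => true) k c) i c') j c''

/-- Integration over a cuboid by successive antiderivatives. -/
theorem integral_Icc_eq_sum (k : Fin 3) {a b : Fin 3 → ℝ} (hab : a ≤ b)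
    {p : Fin 3 → ℝ → Prop} (hp : ∀ l, ∀ᵐ t, p l t) (hpa : ∀ l, p l (a l)) (hpb : ∀ l, p l (b l))
    {g g₁ g₂ g₃ : (Fin 3 → ℝ) → ℝ} (hg : IntegrableOn g (Set.Icc a b))
    (h₁ : IsEdgePrimitive p a b k g g₁)
    (h₂ : IsEdgePrimitive p a b (k.succAbove 0) g₁ g₂)
    (h₃ : IsEdgePrimitive p a b (k.succAbove 1) g₂ g₃) :
    ∫ x in Set.Icc a b, g x = ∑ c, ∑ c', ∑ c'', endSign c * endSign c' * endSign c'' *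
      g₃ (vertex a b (selection k (k.succAbove 0) (k.succAbove 1) c c' c'')) := by
  have hT := isTriple_succAbove k
  rw [integral_Icc_eq_iterated k hab hg a]
  set i := k.succAbove 0
  set j := k.succAbove 1
  obtain ⟨hki, hij, hkj⟩ := hT
  have hpick : ∀ l (c : Bool), p l (if c then b l else a l) := by
    intro l c; cases c <;> simp [hpa, hpb]
  -- On the lines that occur, a coordinate already integrated sits at an end point and one still to
  -- be integrated is almost everywhere good. Hence `p` is needed both almost everywhere and at the
  -- bounds.
  have inner : ∀ s, p j s →
      ∫ t in a i..b i, ∫ r in a k..b k, g (update (update (update a j s) i t) k r) =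
      ∑ c, ∑ c', endSign c * endSign c' * g₂ (update (update (update a k
        (if c then b k else a k)) i (if c' then b i else a i)) j s) := by
    intro s hs
    have hy : ∀ (c : Bool) l, l ≠ i →
        p l (update (update a k (if c then b k else a k)) j s l) := by
      intro c l hl
      by_cases h1 : l = j
      · subst h1; simpa using hs
      by_cases h2 : l = k
      · subst h2; simpa [update_of_ne h1] using hpick _ c
      · simpa [update_of_ne h1, update_of_ne h2] using hpa l
    have e1 : ∫ t in a i..b i, ∫ r in a k..b k, g (update (update (update a j s) i t) k r) =
        ∫ t in a i..b i, ∑ c, endSign c * g₁ (update (update (update a k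
          (if c then b k else a k)) j s) i t) := by
      refine intervalIntegral.integral_congr_ae ?_
      filter_upwards [hp i] with t ht _
      rw [h₁.integral_eq]
      · refine Finset.sum_congr rfl fun c _ => ?_
        rw [update_comm hki.symm, update_comm hkj.symm]
      · intro l hl
        by_cases h1 : l = i
        · subst h1; simpa using ht
        by_cases h2 : l = j
        · subst h2; simpa [update_of_ne h1] using hs
        · simpa [update_of_ne h1, update_of_ne h2] using hpa l
    rw [e1, intervalIntegral.integral_finsetSum
      (fun c _ => ((h₂ _ (hy c)).1.const_mul _))]
    refine Finset.sum_congr rfl fun c _ => ?_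
    rw [intervalIntegral.integral_const_mul, h₂.integral_eq (hy c), Finset.mul_sum]
    refine Finset.sum_congr rfl fun c' _ => ?_
    rw [update_comm hij.symm, mul_assoc]
  have hy : ∀ (c c' : Bool) l, l ≠ j → p l (update (update a k
      (if c then b k else a k)) i (if c' then b i else a i) l) := by
    intro c c' l _
    by_cases h1 : l = i
    · subst h1; simpa using hpick _ c'
    by_cases h2 : l = k
    · subst h2; simpa [update_of_ne h1] using hpick _ c
    · simpa [update_of_ne h1, update_of_ne h2] using hpa l
  rw [intervalIntegral.integral_congr_ae (g := fun s => ∑ c, ∑ c', endSign c * endSign c' *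
    g₂ (update (update (update a k (if c then b k else a k)) i (if c' then b i else a i)) j s))
    (by filter_upwards [hp j] with s hs _ using inner s hs)]
  rw [intervalIntegral.integral_finsetSum fun c _ => ?_]
  · refine Finset.sum_congr rfl fun c _ => ?_
    rw [intervalIntegral.integral_finsetSum fun c' _ => ?_]
    · refine Finset.sum_congr rfl fun c' _ => ?_
      rw [intervalIntegral.integral_const_mul, h₃.integral_eq (hy c c'), Finset.mul_sum]
      refine Finset.sum_congr rfl fun c'' _ => ?_
      rw [← mul_assoc]
      congr 2
      funext l
      have hl := IsTriple.eq_or ⟨hki, hij, hkj⟩ l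
      by_cases h1 : l = j
      · subst h1; simp [vertex, selection]
      by_cases h2 : l = i
      · subst h2; simp [vertex, selection, update_of_ne h1]
      · have h3 : l = k := by tauto
        subst h3; simp [vertex, selection, update_of_ne h1, update_of_ne h2]
    · exact (h₃ _ (hy c c')).1.const_mul _
  · have := IntervalIntegrable.sum Finset.univ (fun c' _ =>
      (h₃ _ (hy c c')).1.const_mul (endSign c * endSign c'))
    simpa only [Finset.sum_fn] using this

/-! ### Integrability of the kernels -/

theorem integrableOn_abs_rpow (R : ℝ) {r : ℝ} (hr : -1 < r) :
    IntegrableOn (fun t : ℝ => |t| ^ r) (Set.Icc (-R) R) := by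
  rcases lt_or_ge R 0 with hR | hR
  · simp [Set.Icc_eq_empty (by linarith : ¬ -R ≤ R)]
  have h0 : IntervalIntegrable (fun t : ℝ => |t| ^ r) volume 0 R := by
    refine (intervalIntegral.intervalIntegrable_rpow' hr).congr fun t ht => ?_
    rw [Set.uIoc_of_le hR] at ht
    simp [abs_of_pos ht.1]
  have h1 : IntervalIntegrable (fun t : ℝ => |t| ^ r) volume (-R) 0 := by
    rw [IntervalIntegrable.iff_comp_neg]
    simpa using h0.symm
  have := h1.trans h0
  rwa [intervalIntegrable_iff_integrableOn_Icc_of_le (by linarith)] at this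

/-- One factor `ρ^(-2/3) ≤ |z_l|^(-2/3)` is spent on each coordinate. As `-2/3 > -1`, the product is
integrable over cubes. -/
theorem inv_rho_sq_le {z : Fin 3 → ℝ} (hz : ∀ l, z l ≠ 0) :
    1 / rho z ^ 2 ≤ ∏ l, |z l| ^ (-(2 / 3) : ℝ) := by
  have hp := rho_pos (hz 0)
  have h : ∀ l, rho z ^ (-(2 / 3) : ℝ) ≤ |z l| ^ (-(2 / 3) : ℝ) := fun l =>
    Real.rpow_le_rpow_of_nonpos (abs_pos.mpr (hz l)) (abs_le_rho z l) (by norm_num)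
  calc 1 / rho z ^ 2 = ∏ _l : Fin 3, rho z ^ (-(2 / 3) : ℝ) := by
        rw [Finset.prod_const, Finset.card_univ, Fintype.card_fin, ← Real.rpow_natCast (_ ^ _),
          ← Real.rpow_mul hp.le, one_div, ← Real.rpow_natCast, ← Real.rpow_neg hp.le]
        norm_num
    _ ≤ _ := Finset.prod_le_prod (fun l _ => by positivity) fun l _ => h l

theorem ae_forall_apply_ne (c : Fin 3 → ℝ) : ∀ᵐ z : Fin 3 → ℝ, ∀ l, z l ≠ c l := by
  rw [ae_all_iff]
  intro l
  have := (Measure.quasiMeasurePreserving_eval (μ := fun _ : Fin 3 => (volume : Measure ℝ)) l).ae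
    (p := fun t => t ≠ c l) (by simp [ae_iff])
  exact this

theorem integrableOn_inv_rho_sq (R : ℝ) :
    IntegrableOn (fun z : Fin 3 → ℝ => 1 / rho z ^ 2) (Set.Icc (fun _ => -R) fun _ => R) := by
  have h : IntegrableOn (fun z : Fin 3 → ℝ => ∏ l, |z l| ^ (-(2 / 3) : ℝ))
      (Set.Icc (fun _ => -R) fun _ => R) := by
    rw [IntegrableOn, ← Set.pi_univ_Icc, volume_pi, Measure.restrict_pi_pi]
    exact Integrable.fintype_prod fun _ => integrableOn_abs_rpow R (by norm_num)
  refine Integrable.mono' h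
    (continuous_rho.measurable.pow_const 2 |>.const_div 1).aestronglyMeasurable ?_
  filter_upwards [ae_restrict_of_ae (ae_forall_apply_ne 0)] with z hz
  rw [Real.norm_of_nonneg (by positivity)]
  exact inv_rho_sq_le hz

theorem integrableOn_inv_rho (R : ℝ) :
    IntegrableOn (fun z : Fin 3 → ℝ => 1 / rho z) (Set.Icc (fun _ => -R) fun _ => R) := by
  have h1 : IntegrableOn (fun _ : Fin 3 → ℝ => (1 : ℝ)) (Set.Icc (fun _ => -R) fun _ => R) :=
    continuousOn_const.integrableOn_compact isCompact_Icc
  refine Integrable.mono' (h1.add (integrableOn_inv_rho_sq R))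
    (continuous_rho.measurable.const_div 1).aestronglyMeasurable
    (Filter.Eventually.of_forall fun z => ?_)
  have := rho_nonneg z
  rw [Real.norm_of_nonneg (by positivity)]
  have h2 : 1 / rho z ^ 2 = (1 / rho z) ^ 2 := by rw [one_div_pow]
  simp only [Pi.add_apply, h2]
  nlinarith [sq_nonneg (1 / rho z - 1)]

theorem integrableOn_div_rho_cube (j : Fin 3) (R : ℝ) :
    IntegrableOn (fun z : Fin 3 → ℝ => z j / rho z ^ 3) (Set.Icc (fun _ => -R) fun _ => R) := by
  refine Integrable.mono' (integrableOn_inv_rho_sq R)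
    ((measurable_pi_apply j).div (continuous_rho.measurable.pow_const 3)).aestronglyMeasurable
    (Filter.Eventually.of_forall fun z => ?_)
  rcases (rho_nonneg z).eq_or_lt with h | h
  · simp [← h]
  · rw [norm_div, Real.norm_eq_abs, Real.norm_of_nonneg (by positivity),
      div_le_div_iff₀ (by positivity) (by positivity)]
    have := abs_le_rho z j
    nlinarith [pow_pos h 2]

theorem exists_sub_mem_Icc (a b a' b' : Fin 3 → ℝ) :
    ∃ R : ℝ, ∀ x ∈ Set.Icc a b, ∀ y ∈ Set.Icc a' b',
      x - y ∈ Set.Icc (fun _ : Fin 3 => -R) fun _ => R := by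
  have hc : IsCompact ((fun p : (Fin 3 → ℝ) × (Fin 3 → ℝ) => p.1 - p.2) ''
      (Set.Icc a b ×ˢ Set.Icc a' b')) :=
    (isCompact_Icc.prod isCompact_Icc).image (by fun_prop)
  obtain ⟨R, hR⟩ := hc.isBounded.exists_norm_le
  refine ⟨R, fun x hx y hy => ?_⟩
  have h := hR (x - y) ⟨(x, y), ⟨hx, hy⟩, rfl⟩
  have hl : ∀ l, |(x - y) l| ≤ R := fun l => (norm_le_pi_norm (x - y) l).trans h
  exact ⟨fun l => (abs_le.mp (hl l)).1, fun l => (abs_le.mp (hl l)).2⟩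

/-- On the product, `f (x - y)` agrees with the convolution integrand of the indicator of `[a', b']`
and `f` cut off to a cube containing all differences. Both are integrable. -/
theorem integrableOn_comp_sub {f : (Fin 3 → ℝ) → ℝ}
    (hf : ∀ R : ℝ, IntegrableOn f (Set.Icc (fun _ => -R) fun _ => R))
    (a b a' b' : Fin 3 → ℝ) :
    IntegrableOn (fun p : (Fin 3 → ℝ) × (Fin 3 → ℝ) => f (p.1 - p.2))
      (Set.Icc a b ×ˢ Set.Icc a' b') := by
  obtain ⟨R, hR⟩ := exists_sub_mem_Icc a b a' b'
  have h1 : Integrable ((Set.Icc (fun _ : Fin 3 => -R) fun _ => R).indicator f) :=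
    (hf R).integrable_indicator measurableSet_Icc
  have h2 : Integrable ((Set.Icc a' b').indicator fun _ => (1 : ℝ)) :=
    (continuousOn_const.integrableOn_compact isCompact_Icc).integrable_indicator measurableSet_Icc
  have h3 := (h2.convolution_integrand (ContinuousLinearMap.mul ℝ ℝ) h1).integrableOn
    (s := Set.Icc a b ×ˢ Set.Icc a' b')
  refine h3.congr_fun (fun p hp => ?_) (measurableSet_Icc.prod measurableSet_Icc)
  simp only [ContinuousLinearMap.mul_apply', Set.indicator_of_mem hp.2,
    Set.indicator_of_mem (hR p.1 hp.1 p.2 hp.2), one_mul]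

theorem integrableOn_comp_sub_left {f : (Fin 3 → ℝ) → ℝ}
    (hf : ∀ R : ℝ, IntegrableOn f (Set.Icc (fun _ => -R) fun _ => R))
    (x a' b' : Fin 3 → ℝ) :
    IntegrableOn (fun y => f (x - y)) (Set.Icc a' b') := by
  obtain ⟨R, hR⟩ := exists_sub_mem_Icc x x a' b'
  have h1 : Integrable ((Set.Icc (fun _ : Fin 3 => -R) fun _ => R).indicator f) :=
    (hf R).integrable_indicator measurableSet_Icc
  refine (h1.comp_sub_left x).integrableOn.congr_fun (fun y hy => ?_) measurableSet_Icc
  simp only [Set.indicator_of_mem (hR x (Set.left_mem_Icc.mpr le_rfl) y hy)]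

/-! ### Antiderivatives of the kernels -/

/-- Two differences are nonzero, so `ρ > 0`, and at least one of the two has an index other than
`m`, which keeps `z_m/ρ` inside `(-1, 1)`. -/
theorem isLineContinuous_of_mem_polySpan {S : Set ((Fin 3 → ℝ) → ℝ)}
    (hS : ∀ g ∈ S, IsRegularTerm g ∨ (g = fun z => 1 / rho z) ∨ (∃ m, g = artanhTerm m) ∨
      ∃ m, g = fun z => z m / rho z ^ 3)
    {f : (PairVar → ℝ) → ℝ} (hf : f ∈ polySpan S) : IsLineContinuous f := by
  intro i w hw
  obtain ⟨j, k, h⟩ := exists_isTriple i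
  have hp := (rho_pos (hw j h.1.symm)).ne'
  refine continuousAt_of_mem_polySpan (fun g hg => ?_) hf
  rcases hS g hg with hg | rfl | ⟨m, rfl⟩ | ⟨m, rfl⟩
  · exact hg.continuous.continuousAt
  · exact continuousAt_const.div continuous_rho.continuousAt hp
  · by_cases hm : j = m
    · subst hm
      exact continuousAt_artanhTerm h.2.1.symm (hw k h.2.2.symm)
    · exact continuousAt_artanhTerm hm (hw j h.1.symm)
  · exact (continuous_apply m).continuousAt.div (continuous_rho.continuousAt.pow 3)
      (pow_ne_zero 3 hp)

/-- The terms that occur in the antiderivative of a kernel along the first coordinate `k`. -/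
def firstTerms (k : Fin 3) : Set ((Fin 3 → ℝ) → ℝ) :=
  insert (fun z => 1 / rho z) (insert (artanhTerm k) regularTerms)

/-- The terms that occur in the antiderivative of a kernel along two coordinates, the second of
which is `i`. -/
def secondTerms (i : Fin 3) : Set ((Fin 3 → ℝ) → ℝ) := insert (artanhTerm i) regularTerms

theorem isLineContinuous_of_mem_polySpan_firstTerms {k : Fin 3} {f : (PairVar → ℝ) → ℝ}
    (hf : f ∈ polySpan (firstTerms k)) : IsLineContinuous f := by
  refine isLineContinuous_of_mem_polySpan ?_ hf
  rintro g (rfl | rfl | hg)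
  · exact Or.inr (Or.inl rfl)
  · exact Or.inr (Or.inr (Or.inl ⟨k, rfl⟩))
  · exact Or.inl hg

theorem isLineContinuous_of_mem_polySpan_secondTerms {i : Fin 3} {f : (PairVar → ℝ) → ℝ}
    (hf : f ∈ polySpan (secondTerms i)) : IsLineContinuous f :=
  isLineContinuous_of_mem_polySpan_firstTerms (polySpan_mono (Set.subset_insert _ _) hf)

/-- The term `1/ρ` produces `artanh(z_i/ρ)`, while `artanh(z_k/ρ)` becomes regular: integration by
parts along `i ≠ k` gives it the factor `z_i`. -/
theorem polySpan_firstTerms_le_primitive {k i : Fin 3} (h : k ≠ i) :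
    polySpan (firstTerms k) ≤ primitive (Sum.inr i) (polySpan (secondTerms i)) := by
  have hS : regularTerms ⊆ secondTerms i := Set.subset_insert _ _
  obtain ⟨j, hT⟩ := exists_isTriple_of_ne h
  refine polySpan_le_primitive ?_
  rintro g (rfl | rfl | hg) p
  · exact pow_mul_inv_rho_mem_primitive hS (Set.mem_insert _ _) p
  · exact pow_mul_artanhTerm_mem_primitive (v := Sum.inr i) (i := i) hS rfl hT.swap' p
  · exact pow_mul_regularTerm_mem_primitive hS hg p

theorem polySpan_secondTerms_le_primitive {i j : Fin 3} (h : i ≠ j) :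
    polySpan (secondTerms i) ≤ primitive (Sum.inr j) (polySpan regularTerms) := by
  obtain ⟨k, hT⟩ := exists_isTriple_of_ne h
  refine polySpan_le_primitive ?_
  rintro g (rfl | hg) p
  · exact pow_mul_artanhTerm_mem_primitive (v := Sum.inr j) (i := j) subset_rfl rfl hT.swap' p
  · exact pow_mul_regularTerm_mem_primitive subset_rfl hg p

theorem elim_update_inr (x y : Fin 3 → ℝ) (l : Fin 3) (t : ℝ) :
    Sum.elim x (update y l t) = update (Sum.elim x y) (Sum.inr l) t :=
  Sum.update_elim_inr.symm

theorem elim_update_inl (x y : Fin 3 → ℝ) (l : Fin 3) (t : ℝ) :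
    Sum.elim (update x l t) y = update (Sum.elim x y) (Sum.inl l) t :=
  Sum.update_elim_inl.symm

theorem isEdgePrimitive_inr {F f : (PairVar → ℝ) → ℝ} (hF : IsLineContinuous F)
    (hf : IsLineContinuous f) {l : Fin 3}
    (hd : ∀ w ∈ generic, HasDerivAt (fun t => F (update w (Sum.inr l) t)) (f w) (w (Sum.inr l)))
    (x a b : Fin 3 → ℝ) :
    IsEdgePrimitive (fun i t => t ≠ x i) a b l (fun y => f (Sum.elim x y))
      fun y => F (Sum.elim x y) := by
  intro y hy
  have hw : ∀ i, i ≠ axis (Sum.inr l) → diff (Sum.elim x y) i ≠ 0 := fun i hi =>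
    sub_ne_zero.mpr (hy i hi).symm
  simp only [elim_update_inr]
  exact ⟨(hf.continuous_update hw).intervalIntegrable _ _, integral_update_eq_sub hF hf hd hw _ _⟩

theorem isEdgePrimitive_inl {F f : (PairVar → ℝ) → ℝ} (hF : Continuous F)
    (hf : Continuous f) {l : Fin 3}
    (hd : ∀ w ∈ generic, HasDerivAt (fun t => F (update w (Sum.inl l) t)) (f w) (w (Sum.inl l)))
    (y a b : Fin 3 → ℝ) :
    IsEdgePrimitive (fun _ _ => True) a b l (fun x => f (Sum.elim x y))
      fun x => F (Sum.elim x y) := by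
  intro x _
  simp only [elim_update_inl]
  exact ⟨(hf.comp (continuous_const.update _ continuous_id)).intervalIntegrable _ _,
    integral_update_eq_sub_of_continuous hF hf hd _ _ _⟩

/-- The vertex selections with respect to the ordering `k`, `k.succAbove 0`, `k.succAbove 1` of
the coordinates. -/
def selectionAt (k : Fin 3) (c : Bool × Bool × Bool) : Fin 3 → Bool :=
  selection k (k.succAbove 0) (k.succAbove 1) c.1 c.2.1 c.2.2

/-- The product of the signs of the end points selected by `c`. -/
def cornerSign (c : Bool × Bool × Bool) : ℚ :=
  (if c.1 then 1 else -1) * (if c.2.1 then 1 else -1) * (if c.2.2 then 1 else -1)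

theorem endSign_mul_mul (c c' c'' : Bool) :
    endSign c * endSign c' * endSign c'' = (cornerSign (c, c', c'') : ℝ) := by
  cases c <;> cases c' <;> cases c'' <;> norm_num [endSign, cornerSign]

/-- Integration of a kernel over the second point. -/
theorem exists_integral_second_eq {k : Fin 3} {K : (PairVar → ℝ) → ℝ} (hK : IsLineContinuous K)
    (hp : K ∈ primitive (Sum.inr k) (polySpan (firstTerms k))) :
    ∃ F ∈ polySpan regularTerms, ∀ x a b : Fin 3 → ℝ, a ≤ b → (∀ l, x l ≠ a l) →
      (∀ l, x l ≠ b l) → IntegrableOn (fun y => K (Sum.elim x y)) (Set.Icc a b) →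
      ∫ y in Set.Icc a b, K (Sum.elim x y) =
        ∑ c, (cornerSign c : ℝ) * F (Sum.elim x (vertex a b (selectionAt k c))) := by
  obtain ⟨hki, hij, hkj⟩ := isTriple_succAbove k
  obtain ⟨F₁, hF₁, h₁⟩ := hp
  obtain ⟨F₂, hF₂, h₂⟩ := polySpan_firstTerms_le_primitive hki hF₁
  obtain ⟨F₃, hF₃, h₃⟩ := polySpan_secondTerms_le_primitive hij hF₂
  have c₁ := isLineContinuous_of_mem_polySpan_firstTerms hF₁
  have c₂ := isLineContinuous_of_mem_polySpan_secondTerms hF₂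
  have c₃ : IsLineContinuous F₃ := fun _ _ _ =>
    (continuous_of_mem_polySpan_regularTerms hF₃).continuousAt
  refine ⟨F₃, hF₃, fun x a b hab ha hb hInt => ?_⟩
  -- The condition `y_i ≠ x_i` fails only on a null set, and holds at the bounds by the choice of
  -- `x`.
  rw [integral_Icc_eq_sum k hab (p := fun i t => t ≠ x i) (fun l => by simp [ae_iff])
    (fun l => (ha l).symm) (fun l => (hb l).symm) hInt (isEdgePrimitive_inr c₁ hK h₁ x a b)
    (isEdgePrimitive_inr c₂ c₁ h₂ x a b) (isEdgePrimitive_inr c₃ c₂ h₃ x a b)]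
  simp only [Fintype.sum_prod_type, endSign_mul_mul, selectionAt]

/-- Integration of a regular function over the first point. -/
theorem exists_integral_first_eq {f : (PairVar → ℝ) → ℝ} (hf : f ∈ polySpan regularTerms) :
    ∃ F ∈ polySpan regularTerms, ∀ y a b : Fin 3 → ℝ, a ≤ b →
      ∫ x in Set.Icc a b, f (Sum.elim x y) =
        ∑ c, (cornerSign c : ℝ) * F (Sum.elim (vertex a b (selectionAt 0 c)) y) := by
  obtain ⟨F₁, hF₁, h₁⟩ := polySpan_regularTerms_le_primitive (Sum.inl 0) hf
  obtain ⟨F₂, hF₂, h₂⟩ :=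
    polySpan_regularTerms_le_primitive (Sum.inl ((0 : Fin 3).succAbove 0)) hF₁
  obtain ⟨F₃, hF₃, h₃⟩ :=
    polySpan_regularTerms_le_primitive (Sum.inl ((0 : Fin 3).succAbove 1)) hF₂
  have c₀ := continuous_of_mem_polySpan_regularTerms hf
  have c₁ := continuous_of_mem_polySpan_regularTerms hF₁
  have c₂ := continuous_of_mem_polySpan_regularTerms hF₂
  have c₃ := continuous_of_mem_polySpan_regularTerms hF₃
  refine ⟨F₃, hF₃, fun y a b hab => ?_⟩
  have hc : Continuous fun x => f (Sum.elim x y) := c₀.comp (by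
    refine continuous_pi fun u => ?_
    rcases u with i | i <;> simp only [Sum.elim_inl, Sum.elim_inr] <;> fun_prop)
  rw [integral_Icc_eq_sum 0 hab (p := fun _ _ => True) (fun _ => by simp) (fun _ => trivial)
    (fun _ => trivial) (hc.continuousOn.integrableOn_compact isCompact_Icc)
    (isEdgePrimitive_inl c₁ c₀ h₁ y a b)
    (isEdgePrimitive_inl c₂ c₁ h₂ y a b) (isEdgePrimitive_inl c₃ c₂ h₃ y a b)]
  simp only [Fintype.sum_prod_type, endSign_mul_mul, selectionAt]

/-- The double integral of a kernel in terms of a regular function. -/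
theorem exists_doubleIntegral_eq {k : Fin 3} {K : (PairVar → ℝ) → ℝ} (hK : IsLineContinuous K)
    (hp : K ∈ primitive (Sum.inr k) (polySpan (firstTerms k)))
    (hInt : ∀ x a b : Fin 3 → ℝ, IntegrableOn (fun y => K (Sum.elim x y)) (Set.Icc a b)) :
    ∃ F ∈ polySpan regularTerms, ∀ a b a' b' : Fin 3 → ℝ, a ≤ b → a' ≤ b' →
      doubleIntegral (fun x y => K (Sum.elim x y)) a b a' b' =
        ∑ c', ∑ c, ((cornerSign c' * cornerSign c : ℚ) : ℝ) *
          F (Sum.elim (vertex a b (selectionAt 0 c)) (vertex a' b' (selectionAt k c'))) := by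
  obtain ⟨f, hf, h₁⟩ := exists_integral_second_eq hK hp
  obtain ⟨F, hF, h₂⟩ := exists_integral_first_eq hf
  refine ⟨F, hF, fun a b a' b' hab hab' => ?_⟩
  have hc : ∀ y, Continuous fun x => f (Sum.elim x y) := fun y =>
    (continuous_of_mem_polySpan_regularTerms hf).comp (by
      refine continuous_pi fun u => ?_
      rcases u with i | i <;> simp only [Sum.elim_inl, Sum.elim_inr] <;> fun_prop)
  rw [doubleIntegral]
  -- The excluded `x`, those sharing a coordinate with a bound of the second cuboid, form a null
  -- set.
  rw [integral_congr_ae (g := fun x => ∑ c', (cornerSign c' : ℝ) *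
    f (Sum.elim x (vertex a' b' (selectionAt k c')))) (by
      filter_upwards [ae_restrict_of_ae (ae_forall_apply_ne a'),
        ae_restrict_of_ae (ae_forall_apply_ne b')] with x hx hx'
      exact h₁ x a' b' hab' hx hx' (hInt x a' b'))]
  rw [integral_finsetSum _ fun c' _ => ?_]
  · refine Finset.sum_congr rfl fun c' _ => ?_
    rw [integral_const_mul, h₂ _ _ _ hab, Finset.mul_sum]
    refine Finset.sum_congr rfl fun c _ => ?_
    push_cast
    ring
  · exact ((hc _).const_mul _).continuousOn.integrableOn_compact isCompact_Icc

/-! ### Elementary combinations -/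

theorem elementaryCombination_add (A B C A' B' C' : Coeffs) (a b a' b' : Fin 3 → ℝ) :
    elementaryCombination (A + A') (B + B') (C + C') a b a' b' =
      elementaryCombination A B C a b a' b' + elementaryCombination A' B' C' a b a' b' := by
  simp only [elementaryCombination, ← Finset.sum_add_distrib, Pi.add_apply, map_add]
  refine Finset.sum_congr rfl fun s _ => Finset.sum_congr rfl fun s' _ =>
    Finset.sum_congr rfl fun π _ => ?_
  split_ifs
  · ring
  · simp

theorem elementaryCombination_smul (c : ℚ) (A B C : Coeffs) (a b a' b' : Fin 3 → ℝ) :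
    elementaryCombination (c • A) (c • B) (c • C) a b a' b' =
      c * elementaryCombination A B C a b a' b' := by
  simp only [elementaryCombination, Finset.mul_sum, Pi.smul_apply, map_smul, Rat.smul_def]
  refine Finset.sum_congr rfl fun s _ => Finset.sum_congr rfl fun s' _ =>
    Finset.sum_congr rfl fun π _ => ?_
  split_ifs
  · ring
  · simp

/-- The functions of the integration bounds that are elementary combinations. -/
noncomputable def elementary :
    Submodule ℚ ((Fin 3 → ℝ) → (Fin 3 → ℝ) → (Fin 3 → ℝ) → (Fin 3 → ℝ) → ℝ) where
  carrier := {Φ | ∃ A B C : Coeffs, Φ = elementaryCombination A B C}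
  add_mem' := by
    rintro _ _ ⟨A, B, C, rfl⟩ ⟨A', B', C', rfl⟩
    exact ⟨A + A', B + B', C + C', by
      funext a b a' b'; exact (elementaryCombination_add A B C A' B' C' a b a' b').symm⟩
  zero_mem' := ⟨0, 0, 0, by funext a b a' b'; simp [elementaryCombination]⟩
  smul_mem' := by
    rintro c _ ⟨A, B, C, rfl⟩
    exact ⟨c • A, c • B, c • C, by
      funext a b a' b'
      rw [elementaryCombination_smul]
      simp [Rat.smul_def]⟩

open Classical in
/-- The coefficients that vanish but for one pair of vertices and one permutation. -/
noncomputable def singleCoeffs (s s' : Fin 3 → Bool) (π : Equiv.Perm (Fin 3))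
    (P : MvPolynomial BoundVar ℚ) : Coeffs :=
  Pi.single s (Pi.single s' (Pi.single π P))

open Classical in
theorem single_mem_elementary (s s' : Fin 3 → Bool) (π : Equiv.Perm (Fin 3))
    (P Q R : MvPolynomial BoundVar ℚ) :
    (fun a b a' b' : Fin 3 → ℝ =>
      if delta a b a' b' s s' π 0 ≠ 0 then
        MvPolynomial.aeval (bounds a b a' b') P * (1 / rho (delta a b a' b' s s' π)) +
        MvPolynomial.aeval (bounds a b a' b') Q *
          Real.artanh (delta a b a' b' s s' π 2 / rho (delta a b a' b' s s' π)) +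
        MvPolynomial.aeval (bounds a b a' b') R *
          Real.arctan (delta a b a' b' s s' π 1 * delta a b a' b' s s' π 2 /
            (delta a b a' b' s s' π 0 * rho (delta a b a' b' s s' π)))
      else 0) ∈ elementary := by
  refine ⟨singleCoeffs s s' π P, singleCoeffs s s' π Q, singleCoeffs s s' π R, ?_⟩
  funext a b a' b'
  unfold elementaryCombination singleCoeffs
  rw [Finset.sum_eq_single s, Finset.sum_eq_single s', Finset.sum_eq_single π]
  · simp
  · intro π' _ h; simp [h]
  · simp
  · intro t _ h; simp [h]
  · simp
  · intro t _ h; simp [h]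
  · simp

/-- The bound that is the coordinate `u` of a pair of selected vertices. -/
def boundOf (s s' : Fin 3 → Bool) : PairVar → BoundVar
  | Sum.inl i => Sum.inl (if s i then Sum.inr i else Sum.inl i)
  | Sum.inr i => Sum.inr (if s' i then Sum.inr i else Sum.inl i)

theorem bounds_comp_boundOf (s s' : Fin 3 → Bool) (a b a' b' : Fin 3 → ℝ) :
    bounds a b a' b' ∘ boundOf s s' = Sum.elim (vertex a b s) (vertex a' b' s') := by
  funext u
  rcases u with i | i
  · cases h : s i <;> simp [bounds, boundOf, vertex, h]
  · cases h : s' i <;> simp [bounds, boundOf, vertex, h]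

theorem delta_eq (a b a' b' : Fin 3 → ℝ) (s s' : Fin 3 → Bool) (π : Equiv.Perm (Fin 3))
    (l : Fin 3) :
    delta a b a' b' s s' π l = diff (Sum.elim (vertex a b s) (vertex a' b' s')) (π l) := rfl

theorem rho_delta (a b a' b' : Fin 3 → ℝ) (s s' : Fin 3 → Bool) (π : Equiv.Perm (Fin 3)) :
    rho (delta a b a' b' s s' π) = rho (diff (Sum.elim (vertex a b s) (vertex a' b' s'))) := by
  have h : IsTriple (π 0) (π 1) (π 2) :=
    ⟨π.injective.ne (by decide), π.injective.ne (by decide), π.injective.ne (by decide)⟩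
  rw [rho_eq h (diff _)]
  rfl

open Classical in
/-- A version of `single_mem_elementary` with polynomials in the coordinates of the vertices. -/
theorem pair_single_mem_elementary (s s' : Fin 3 → Bool) {i j k : Fin 3} (h : IsTriple i j k)
    (P Q R : MvPolynomial PairVar ℚ) :
    (fun a b a' b' : Fin 3 → ℝ =>
      let w := Sum.elim (vertex a b s) (vertex a' b' s')
      if diff w i ≠ 0 then
        MvPolynomial.aeval w P * (1 / rho (diff w)) +
        MvPolynomial.aeval w Q * artanhTerm k (diff w) +
        MvPolynomial.aeval w R * arctanTerm i j k (diff w)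
      else 0) ∈ elementary := by
  obtain ⟨π, rfl, rfl, rfl⟩ := h.exists_perm
  have := single_mem_elementary s s' π (MvPolynomial.rename (boundOf s s') P)
    (MvPolynomial.rename (boundOf s s') Q) (MvPolynomial.rename (boundOf s s') R)
  simp only [rho_delta, delta_eq, MvPolynomial.aeval_rename, bounds_comp_boundOf] at this
  exact this

/-- The factor `z_i` is absorbed into the polynomial coefficient and `i` becomes the first index of
the permutation. Terms omitted because `δ₁ = 0` thus have coefficient zero. -/
theorem regular_mem_elementary {F : (PairVar → ℝ) → ℝ} (hF : F ∈ polySpan regularTerms)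
    (s s' : Fin 3 → Bool) :
    (fun a b a' b' : Fin 3 → ℝ => F (Sum.elim (vertex a b s) (vertex a' b' s'))) ∈
      elementary := by
  induction hF using Submodule.span_induction with
  | mem f hf =>
    obtain ⟨P, g, hg, rfl⟩ := hf
    cases hg with
    | rho =>
      let D : Fin 3 → MvPolynomial PairVar ℚ := fun i =>
        MvPolynomial.X (Sum.inl i) - MvPolynomial.X (Sum.inr i)
      have h := fun i j k h => pair_single_mem_elementary s s' (i := i) (j := j) (k := k) h
        (P * D i ^ 2) 0 0
      -- Three cyclic permutations realize `ρ = ∑ z_i² · (1/ρ)`, one summand for each choice of the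
      -- first index; if `ρ = 0`, both sides vanish.
      refine (congrArg (· ∈ elementary) ?_).mp (add_mem (add_mem
        (h 0 1 2 (by unfold IsTriple; decide)) (h 1 2 0 (by unfold IsTriple; decide)))
        (h 2 0 1 (by unfold IsTriple; decide)))
      funext a b a' b'
      simp only [Pi.add_apply]
      generalize Sum.elim (vertex a b s) (vertex a' b' s') = w
      have hD : ∀ i, MvPolynomial.aeval w (P * D i ^ 2) =
          MvPolynomial.aeval w P * diff w i ^ 2 := fun i => by
        simp only [D, map_mul, map_pow, map_sub, MvPolynomial.aeval_X, diff]
      have hif : ∀ i, (if diff w i ≠ 0 then MvPolynomial.aeval w P * diff w i ^ 2 *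
          (1 / rho (diff w)) else 0) =
          MvPolynomial.aeval w P * diff w i ^ 2 * (1 / rho (diff w)) := fun i => by
        split_ifs with hi
        · rfl
        · rw [not_not.mp hi]; simp
      simp only [hD, map_zero, zero_mul, add_zero, hif]
      have hs := rho_sq (i := 0) (j := 1) (k := 2) (by unfold IsTriple; decide) (diff w)
      rcases (rho_nonneg (diff w)).eq_or_lt with h0 | h0
      · simp [← h0]
      · field_simp
        rw [hs]
    | @artanh i k h =>
      obtain ⟨j, hT⟩ := exists_isTriple_of_ne h
      refine (congrArg (· ∈ elementary) ?_).mp (pair_single_mem_elementary s s' hT.swap 0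
        (P * (MvPolynomial.X (Sum.inl i) - MvPolynomial.X (Sum.inr i))) 0)
      funext a b a' b'
      generalize Sum.elim (vertex a b s) (vertex a' b' s') = w
      simp only [map_mul, map_sub, MvPolynomial.aeval_X, map_zero, zero_mul, add_zero, zero_add,
        ← diff.eq_def w, mul_assoc]
      split_ifs with hi
      · rfl
      · rw [not_not.mp hi]; simp
    | @arctan i j k h =>
      refine (congrArg (· ∈ elementary) ?_).mp (pair_single_mem_elementary s s' h 0 0
        (P * (MvPolynomial.X (Sum.inl i) - MvPolynomial.X (Sum.inr i))))
      funext a b a' b'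
      generalize Sum.elim (vertex a b s) (vertex a' b' s') = w
      simp only [map_mul, map_sub, MvPolynomial.aeval_X, map_zero, zero_mul, zero_add, mul_assoc]
      split_ifs with hi
      · rfl
      · rw [not_not.mp hi]; simp
  | zero => exact elementary.zero_mem
  | add f₁ f₂ _ _ h₁ h₂ => exact add_mem h₁ h₂
  | smul c f _ h => exact elementary.smul_mem c h

/-! ### The Newton potential and the force -/

/-- The weight as a polynomial. -/
noncomputable def weightPoly (n m : Fin 3 → ℕ) : MvPolynomial PairVar ℚ :=
  (∏ i, MvPolynomial.X (Sum.inl i) ^ n i) * ∏ i, MvPolynomial.X (Sum.inr i) ^ m i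

theorem aeval_weightPoly (n m : Fin 3 → ℕ) (x y : Fin 3 → ℝ) :
    MvPolynomial.aeval (Sum.elim x y) (weightPoly n m) = weight n m x y := by
  simp [weightPoly, weight]

theorem diff_elim (x y : Fin 3 → ℝ) : diff (Sum.elim x y) = x - y := rfl

theorem dist3_eq (x y : Fin 3 → ℝ) : dist3 x y = rho (x - y) := by
  simp [dist3, rho, Fin.sum_univ_three]

theorem continuous_weight (n m : Fin 3 → ℕ) :
    Continuous fun p : (Fin 3 → ℝ) × (Fin 3 → ℝ) => weight n m p.1 p.2 := by
  unfold weight; fun_prop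

/-- A kernel of the form `weight · g (x - y)` whose factor `g` has suitable antiderivatives is
integrable, and its double integral is an elementary combination. -/
theorem exists_coeffs (n m : Fin 3 → ℕ) (k : Fin 3) {g : (Fin 3 → ℝ) → ℝ}
    (hg : (g = fun z => 1 / rho z) ∨ ∃ l, g = fun z => z l / rho z ^ 3)
    (hInt : ∀ R : ℝ, IntegrableOn g (Set.Icc (fun _ => -R) fun _ => R))
    (hp : ∀ p : ℕ, (fun w => diff w k ^ p * g (diff w)) ∈
      primitive (Sum.inr k) (polySpan (firstTerms k)))
    {K : (Fin 3 → ℝ) → (Fin 3 → ℝ) → ℝ} (hK : ∀ x y, K x y = weight n m x y * g (x - y)) :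
    ∃ A B C : Coeffs, ∀ a b a' b' : Fin 3 → ℝ, a ≤ b → a' ≤ b' →
      IntegrableOn (fun p : (Fin 3 → ℝ) × (Fin 3 → ℝ) => K p.1 p.2)
          (Set.Icc a b ×ˢ Set.Icc a' b') ∧
        doubleIntegral K a b a' b' = elementaryCombination A B C a b a' b' := by
  let K' : (PairVar → ℝ) → ℝ := fun w => MvPolynomial.aeval w (weightPoly n m) * g (diff w)
  have hK' : K = fun x y => K' (Sum.elim x y) := by
    funext x y
    rw [hK]
    simp only [K', aeval_weightPoly, diff_elim]
  have hcont : IsLineContinuous K' := by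
    refine isLineContinuous_of_mem_polySpan (S := {g}) ?_ (aeval_mul_comp_diff_mem _ rfl)
    rintro _ rfl
    rcases hg with hg | hg
    · exact Or.inr (Or.inl hg)
    · exact Or.inr (Or.inr (Or.inr hg))
  have hsec : ∀ x a b : Fin 3 → ℝ,
      IntegrableOn (fun y => K' (Sum.elim x y)) (Set.Icc a b) := by
    intro x a b
    simp only [K', aeval_weightPoly, diff_elim]
    exact (integrableOn_comp_sub_left hInt x a b).continuousOn_mul
      ((continuous_weight n m).comp (by fun_prop : Continuous fun y => (x, y))).continuousOn
      isCompact_Icc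
  obtain ⟨F, hF, h⟩ := exists_doubleIntegral_eq hcont (aeval_mul_mem_primitive hp _) hsec
  have hel : (∑ c', ∑ c, (cornerSign c' * cornerSign c) • fun a b a' b' : Fin 3 → ℝ =>
      F (Sum.elim (vertex a b (selectionAt 0 c)) (vertex a' b' (selectionAt k c')))) ∈
        elementary :=
    sum_mem fun c' _ => sum_mem fun c _ => elementary.smul_mem _ (regular_mem_elementary hF _ _)
  obtain ⟨A, B, C, hABC⟩ := hel
  refine ⟨A, B, C, fun a b a' b' hab hab' => ⟨?_, ?_⟩⟩
  · simp only [hK]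
    exact (integrableOn_comp_sub hInt a b a' b').continuousOn_mul
      (continuous_weight n m).continuousOn (isCompact_Icc.prod isCompact_Icc)
  · rw [hK', h a b a' b' hab hab', ← hABC]
    simp [Finset.sum_apply, Rat.smul_def]

theorem exists_potential_coeffs (n m : Fin 3 → ℕ) :
    ∃ A B C : Coeffs, ∀ a b a' b' : Fin 3 → ℝ, a ≤ b → a' ≤ b' →
      IntegrableOn (fun p : (Fin 3 → ℝ) × (Fin 3 → ℝ) => potentialKernel n m p.1 p.2)
          (Set.Icc a b ×ˢ Set.Icc a' b') ∧
        potential n m a b a' b' = elementaryCombination A B C a b a' b' := by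
  -- For the potential the first direction is arbitrary.
  refine exists_coeffs n m 0 (Or.inl rfl) integrableOn_inv_rho (fun p => ?_) fun x y => ?_
  · refine pow_mul_inv_rho_mem_primitive (v := Sum.inr 0) ?_ ?_ p
    · exact (Set.subset_insert _ _).trans (Set.subset_insert _ _)
    · exact Set.mem_insert_of_mem _ (Set.mem_insert _ _)
  · rw [potentialKernel, dist3_eq, mul_one_div]

theorem exists_force_coeffs (n m : Fin 3 → ℕ) (j : Fin 3) :
    ∃ A B C : Coeffs, ∀ a b a' b' : Fin 3 → ℝ, a ≤ b → a' ≤ b' →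
      IntegrableOn (fun p : (Fin 3 → ℝ) × (Fin 3 → ℝ) => forceKernel n m j p.1 p.2)
          (Set.Icc a b ×ˢ Set.Icc a' b') ∧
        force n m j a b a' b' = elementaryCombination A B C a b a' b' := by
  -- The direction `j` of the force must come first: only along it does `z_j/ρ³` integrate to
  -- `-1/ρ`.
  refine exists_coeffs n m j (Or.inr ⟨j, rfl⟩) (integrableOn_div_rho_cube j) (fun p => ?_)
    fun x y => ?_
  · refine pow_mul_div_rho_cube_mem_primitive (v := Sum.inr j) ?_ ?_ ?_ p
    · exact (Set.subset_insert _ _).trans (Set.subset_insert _ _)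
    · exact Set.mem_insert_of_mem _ (Set.mem_insert _ _)
    · exact Set.mem_insert _ _
  · rw [forceKernel, dist3_eq, Pi.sub_apply]
    ring

end Cuboid

theorem mainTheorem1 (n m : Fin 3 → ℕ) :
    (∃ A B C : Cuboid.Coeffs, ∀ a b a' b' : Fin 3 → ℝ, a ≤ b → a' ≤ b' →
      IntegrableOn (fun p : (Fin 3 → ℝ) × (Fin 3 → ℝ) => Cuboid.potentialKernel n m p.1 p.2)
          (Set.Icc a b ×ˢ Set.Icc a' b') ∧
        Cuboid.potential n m a b a' b' = Cuboid.elementaryCombination A B C a b a' b') ∧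
    ∀ j : Fin 3, ∃ A B C : Cuboid.Coeffs, ∀ a b a' b' : Fin 3 → ℝ, a ≤ b → a' ≤ b' →
      IntegrableOn (fun p : (Fin 3 → ℝ) × (Fin 3 → ℝ) => Cuboid.forceKernel n m j p.1 p.2)
          (Set.Icc a b ×ˢ Set.Icc a' b') ∧
        Cuboid.force n m j a b a' b' = Cuboid.elementaryCombination A B C a b a' b' :=
  ⟨Cuboid.exists_potential_coeffs n m, Cuboid.exists_force_coeffs n m⟩
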